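/- Work over an algebraically closed field. Let $r,d,m_0,m\ge 0$ be integers, let $p_0,p_1,\dots,p_r\in\mathbb{P}^2$ be points in general position (that is, the claim below holds for all $(p_0,\dots,p_r)$ in some nonempty Zariski open set of $(r+1)$-tuples of distinct points, depending only on $r,d,m_0,m$), and let $S$ be the blow-up of $\mathbb{P}^2$ at these points. Write $L(\delta,\mu_0,\mu_1,\dots,\mu_r)$ for the class $\delta H-\sum_{i=0}^r\mu_iE_i$ in $\mathrm{Pic}(S)$, where $H$ is the pullback of a line and $E_i$ is the exceptional curve over $p_i$ (so that $H^2=1$, $E_i^2=-1$, all other products vanish, and $K_S=-3H+\sum_i E_i$); an exponent denotes repetition. A $(-1)$-curve is an irreducible curve $E\subset S$ with $E^2=E\cdot K_S=-1$. Let $\mathcal{L}=\mathcal{L}(d,m_0,m^r)$ be the quasi-homogeneous linear system of plane curves of degree $d$ with multiplicity at least $m_0$ at $p_0$ and at least $m$ at each of $p_1,\dots,p_r$. Suppose that $\mathcal{L}$ is nonempty, and let $E$ be a $(-1)$-curve on $S$ with $E\cdot\mathcal{L}<0$. Then, for some integers $\delta,\mu_0,\mu\ge 0$ and up to a permutation of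 $p_1,\dots,p_r$, the class of $E$ has one of the forms $$\text{(a) } L(\delta,\mu_0,\mu^r),\qquad \text{(b) } L(\delta,\mu_0,\mu-1,\mu^{r-1})\ (r,\mu\ge 1),\qquad \text{(c) } L(\delta,\mu_0,\mu+1,\mu^{r-1})\ (r\ge 1).$$ Moreover, if $[E]=L(\delta,\mu_0,\mu_1,\dots,\mu_r)$, then for every permutation $\sigma$ of $\{1,\dots,r\}$ there is exactly one $(-1)$-curve $E_\sigma$ on $S$ of class $L(\delta,\mu_0,\mu_{\sigma(1)},\dots,\mu_{\sigma(r)})$. Let the compound curve $E_{\rm tot}$ be the sum of the finitely many distinct curves $E_\sigma$. Then $E_{\rm tot}$ has class $L(r\delta,r\mu_0,(r\mu-1)^r)$ in case (b) and $L(r\delta,r\mu_0,(r\mu+1)^r)$ in case (c). -/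

import Mathlib

open scoped LinearAlgebra.Projectivization

namespace PlaneSystems

noncomputable section

/-- The projective plane over `K`. -/
abbrev Plane (K : Type*) [Field K] := ℙ K (Fin 3 → K)

/-! ### General points -/

/-- `F`, a polynomial in `n` groups of three homogeneous coordinates, is homogeneous of degree `e i`
in the `i`-th group, for every `i`. -/
def IsMultihomogeneous {K : Type*} [Field K] {n : ℕ} (F : MvPolynomial (Fin n × Fin 3) K)
    (e : Fin n → ℕ) : Prop :=
  ∀ i, MvPolynomial.IsWeightedHomogeneous (fun x : Fin n × Fin 3 => if x.1 = i then 1 else 0) F (e i)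

/-- The value of a polynomial at (chosen homogeneous coordinates of) an `n`-tuple of points; for a
multihomogeneous polynomial its vanishing does not depend on the choice. -/
def evalAt {K : Type*} [Field K] {n : ℕ} (p : Fin n → Plane K)
    (F : MvPolynomial (Fin n × Fin 3) K) : K :=
  MvPolynomial.eval (fun x => (p x.1).rep x.2) F

/-- Zariski closed subsets of `(ℙ²)ⁿ`: the common zero loci of multihomogeneous polynomials. -/
def IsZariskiClosed {K : Type*} [Field K] {n : ℕ} (Z : Set (Fin n → Plane K)) : Prop :=
  ∃ T : Set (MvPolynomial (Fin n × Fin 3) K), (∀ F ∈ T, ∃ e, IsMultihomogeneous F e) ∧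
    Z = {p | ∀ F ∈ T, evalAt p F = 0}

/-- `P` holds for `n` points in general position: it holds on a nonempty Zariski open
subset of `(ℙ²)ⁿ` consisting of `n`-tuples of distinct points. -/
def ForGeneralPoints (K : Type*) [Field K] (n : ℕ) (P : (Fin n → Plane K) → Prop) : Prop :=
  ∃ U : Set (Fin n → Plane K), IsZariskiClosed Uᶜ ∧ U.Nonempty ∧
    ∀ p ∈ U, Function.Injective p ∧ P p

/-! ### Multiplicities and linear systems -/

/-- The Taylor expansion `f(v + X)` of `f` at `v`. -/
def taylorAt {K : Type*} [Field K] (v : Fin 3 → K) (f : MvPolynomial (Fin 3) K) :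
    MvPolynomial (Fin 3) K :=
  MvPolynomial.aeval (fun i => MvPolynomial.X i + MvPolynomial.C (v i)) f

/-- The plane curve `f = 0` (`f` homogeneous) has multiplicity at least `m` at `q`: all terms of
order less than `m` in the Taylor expansion vanish. -/
def HasMultGE {K : Type*} [Field K] (f : MvPolynomial (Fin 3) K) (q : Plane K) (m : ℕ) : Prop :=
  ∀ k < m, MvPolynomial.homogeneousComponent k (taylorAt q.rep f) = 0

/-- The multiplicity at `q` of the plane curve `f = 0` (`f` homogeneous and nonzero). -/
def multAt {K : Type*} [Field K] (f : MvPolynomial (Fin 3) K) (q : Plane K) : ℕ :=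
  sInf {k | MvPolynomial.homogeneousComponent k (taylorAt q.rep f) ≠ 0}

/-- The space of forms of degree `d` with multiplicity at least `m i` at `p i` for every `i`; the
linear system `𝓛(d, m₁, …, mₙ)` is its projectivization, so it is nonempty iff this
space is not `⊥`. -/
def linearSystem {K : Type*} [Field K] {n : ℕ} (p : Fin n → Plane K) (d : ℕ) (m : Fin n → ℕ) :
    Submodule K (MvPolynomial (Fin 3) K) where
  carrier := {f | f.IsHomogeneous d ∧ ∀ i, HasMultGE f (p i) (m i)}
  zero_mem' := ⟨MvPolynomial.isHomogeneous_zero _ _ _, fun i k _ => by simp [taylorAt]⟩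
  add_mem' := fun {f g} hf hg => ⟨hf.1.add hg.1, fun i k hk => by
    have h1 := hf.2 i k hk
    have h2 := hg.2 i k hk
    simp only [taylorAt] at h1 h2 ⊢
    rw [map_add, map_add, h1, h2, add_zero]⟩
  smul_mem' := fun c f hf => ⟨(MvPolynomial.homogeneousSubmodule (Fin 3) K d).smul_mem c hf.1,
    fun i k hk => by
      have h1 := hf.2 i k hk
      simp only [taylorAt] at h1 ⊢
      rw [map_smul, map_smul, h1, smul_zero]⟩

/-! ### Curves and divisors on the blow-up -/

/-- The Picard lattice of the blow-up of `ℙ²` at `n` points: `(d, m)` is the class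
`d H - ∑ mᵢ Eᵢ`, where `H` is the class of a line and `Eᵢ` that of the `i`-th exceptional curve. -/
abbrev PicClass (n : ℕ) := ℤ × (Fin n → ℤ)

/-- The class `(d, m₀, m₁, …, mᵣ)` on the blow-up at `r + 1` points. -/
def cls {r : ℕ} (d m₀ : ℤ) (m : Fin r → ℤ) : PicClass (r + 1) := (d, Fin.cons m₀ m)

/-- The intersection form, `H² = 1`, `Eᵢ² = -1`, all other products being `0`. -/
def inter {n : ℕ} (a b : PicClass n) : ℤ := a.1 * b.1 - ∑ i, a.2 i * b.2 i

/-- The canonical class `-3 H + ∑ Eᵢ`. -/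
def canonicalClass (n : ℕ) : PicClass n := (-3, fun _ => -1)

/-- A permutation of the last `r` points acts on classes, `m₀` being kept fixed. -/
def permute {r : ℕ} (σ : Equiv.Perm (Fin r)) (a : PicClass (r + 1)) : PicClass (r + 1) :=
  cls a.1 (a.2 0) (fun i => a.2 (σ i).succ)

/-- An irreducible plane curve, given by its homogeneous ideal. -/
structure PlaneCurve (K : Type*) [Field K] where
  ideal : Ideal (MvPolynomial (Fin 3) K)
  exists_eq : ∃ f : MvPolynomial (Fin 3) K, Irreducible f ∧ (∃ d, f.IsHomogeneous d) ∧
    ideal = Ideal.span {f}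

/-- An equation of an irreducible plane curve (unique up to a scalar). -/
def PlaneCurve.eqn {K : Type*} [Field K] (C : PlaneCurve K) : MvPolynomial (Fin 3) K :=
  C.exists_eq.choose

/-- The irreducible curves on the blow-up of the plane at the points `p i`: the exceptional curves
and the strict transforms of the irreducible plane curves. -/
inductive IrredCurve {K : Type*} [Field K] {n : ℕ} (p : Fin n → Plane K)
  | exceptional (i : Fin n) : IrredCurve p
  | strictTransform (C : PlaneCurve K) : IrredCurve p

/-- The class of an irreducible curve on the blow-up: `Eᵢ` for an exceptional curve, and
`d H - ∑ mᵢ Eᵢ` for the strict transform of a plane curve of degree `d` that has multiplicity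
exactly `mᵢ` at `p i`. -/
def IrredCurve.toPic {K : Type*} [Field K] {n : ℕ} {p : Fin n → Plane K} :
    IrredCurve p → PicClass n
  | .exceptional i => (0, fun j => if j = i then -1 else 0)
  | .strictTransform C => ((C.eqn.totalDegree : ℤ), fun i => (multAt C.eqn (p i) : ℤ))

/-- `(-1)`-curves: irreducible curves `E` with `E² = E · K = -1`. -/
def IrredCurve.IsMinusOne {K : Type*} [Field K] {n : ℕ} {p : Fin n → Plane K}
    (E : IrredCurve p) : Prop :=
  inter E.toPic E.toPic = -1 ∧ inter E.toPic (canonicalClass n) = -1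

/-- Divisors on the blow-up. -/
abbrev BlowupDivisor {K : Type*} [Field K] {n : ℕ} (p : Fin n → Plane K) := IrredCurve p →₀ ℤ

/-- The class of a divisor. -/
def divisorClass {K : Type*} [Field K] {n : ℕ} {p : Fin n → Plane K} (D : BlowupDivisor p) :
    PicClass n :=
  D.sum fun C k => k • C.toPic

/-- The curves `E_σ`: those whose class arises from that of `E` by a permutation of the last
`r` points. -/
def conjugates {K : Type*} [Field K] {r : ℕ} {p : Fin (r + 1) → Plane K} (E : IrredCurve p) :
    Set (IrredCurve p) :=
  {F | ∃ σ : Equiv.Perm (Fin r), F.toPic = permute σ E.toPic}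

/-- The compound curve `E_tot`, the sum of the distinct curves `E_σ`. (The sum is meaningful when
there are finitely many of them.) -/
def compound {K : Type*} [Field K] {r : ℕ} {p : Fin (r + 1) → Plane K} (E : IrredCurve p) :
    BlowupDivisor p :=
  ∑ᶠ F ∈ conjugates E, Finsupp.single F 1

end

end PlaneSystems

namespace PlaneSystems

open MvPolynomial

/-! ### Orders of vanishing at the origin, and factors of forms. -/

section Order

variable {σ R : Type*} [CommRing R]

/-! Let $f$ be the equation of $E$. Since $E\cdot\mathcal L<0$, Bézout makes $f$ divide every form
in the system, so $\deg f\le d$ and only finitely many classes matter. Outside finitely many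
hypersurfaces, a class with degree and multiplicities at most $d$ that is effective at the given
points is effective for every choice of points. Relabelling points permutes multiplicities, so
effectivity is invariant under permutations (`FewEffectiveClasses.linearSystem_perm_ne_bot`).
Because $E^2<0$, irreducibility is inherited as well: every permuted class is that of an irreducible
curve $E_\sigma$ (`exists_isIrreducibleForm_perm`), unique by Bézout.

The class of $\mathcal L$ is symmetric, so $E_\sigma\cdot\mathcal L=E\cdot\mathcal L<0$. If
$E_\sigma\ne E$ and $E\cdot E_\sigma\ge 1$, then $E+E_\sigma$ would be nef, yet negative on the
effective class $\mathcal L$; hence $E\cdot E_\sigma=0$ (`DistinctAbscissas.inter_eq_zero`).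
Subtracting $E^2=-1$ gives $\sum_k\mu_k(\mu_k-\mu_{\sigma(k)})=1$ for each $\sigma$ that moves the
vector $\mu$. A transposition turns this into $(\mu_i-\mu_j)^2=1$, and two disjoint transpositions
of unequal entries would give a sum of two positive squares equal to $1$. So at most one entry is
odd, and it differs by one from the others (`eq_update_of_forall_perm`). The compound curve has one
component for each position of the odd entry.

The Bézout inequality comes from a dimension count: forms $Pf+Qg$ of large degree against jets at
the points (`sum_mul_le_of_localExpansion_mem`). -/

theorem mem_pow_idealOfVars_iff_le_order (P : MvPolynomial σ R) (m : ℕ) :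
    P ∈ idealOfVars σ R ^ m ↔ (m : ℕ∞) ≤ (P : MvPowerSeries σ R).order := by
  rw [mem_pow_idealOfVars_iff']
  constructor
  · intro h
    exact MvPowerSeries.nat_le_order fun α hα => by simpa using h α hα
  · intro h α hα
    have := MvPowerSeries.coeff_of_lt_order (f := (P : MvPowerSeries σ R)) (d := α)
      (lt_of_lt_of_le (by exact_mod_cast hα) h)
    simpa using this

theorem homogeneousComponent_eq_zero_iff (P : MvPolynomial σ R) (k : ℕ) :
    homogeneousComponent k P = 0 ↔ ∀ α : σ →₀ ℕ, α.degree = k → P.coeff α = 0 := by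
  constructor
  · intro h α hα
    have := congrArg (coeff α) h
    simpa [coeff_homogeneousComponent, hα] using this
  · intro h
    ext α
    rw [coeff_homogeneousComponent]
    split_ifs with hα
    · simpa using h α hα
    · simp

/-- Translates multiplicity into the order of a power series, which is additive on products over a
domain. -/
theorem forall_homogeneousComponent_eq_zero_iff (P : MvPolynomial σ R) (m : ℕ) :
    (∀ k < m, homogeneousComponent k P = 0) ↔ (m : ℕ∞) ≤ (P : MvPowerSeries σ R).order := by
  rw [← mem_pow_idealOfVars_iff_le_order, mem_pow_idealOfVars_iff']
  simp only [homogeneousComponent_eq_zero_iff]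
  exact ⟨fun h α hα => h _ hα α rfl, fun h k hk α hα => h α (hα ▸ hk)⟩

theorem order_le_totalDegree {P : MvPolynomial σ R} (hP : P ≠ 0) :
    (P : MvPowerSeries σ R).order ≤ P.totalDegree := by
  obtain ⟨α, hα⟩ := MvPolynomial.ne_zero_iff.1 hP
  refine (MvPowerSeries.order_le (d := α) (by simpa using hα)).trans ?_
  exact_mod_cast (le_totalDegree (mem_support_iff.2 hα))

theorem isHomogeneous_of_totalDegree_le_order {P : MvPolynomial σ R}
    (h : (P.totalDegree : ℕ∞) ≤ (P : MvPowerSeries σ R).order) :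
    P.IsHomogeneous P.totalDegree := by
  intro α hα
  change Finsupp.weight (fun _ => 1) α = _
  rw [← Finsupp.degree_eq_weight_one]
  refine le_antisymm (le_totalDegree (mem_support_iff.2 hα)) ?_
  have := MvPowerSeries.order_le (f := (P : MvPowerSeries σ R)) (d := α) (by simpa using hα)
  exact_mod_cast h.trans this

theorem IsHomogeneous.le_order {P : MvPolynomial σ R} {n : ℕ} (hP : P.IsHomogeneous n) :
    (n : ℕ∞) ≤ (P : MvPowerSeries σ R).order :=
  MvPowerSeries.nat_le_order fun α hα => by simpa using hP.coeff_eq_zero hα.ne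

/-- Factors of a nonzero form are forms. -/
theorem IsHomogeneous.left_of_mul [IsDomain R] {P Q : MvPolynomial σ R} {n : ℕ}
    (h : (P * Q).IsHomogeneous n) (h0 : P * Q ≠ 0) : P.IsHomogeneous P.totalDegree := by
  have hP := left_ne_zero_of_mul h0
  have hQ := right_ne_zero_of_mul h0
  apply isHomogeneous_of_totalDegree_le_order
  -- Order and total degree are both additive, and order is at most degree for each factor; equality
  -- for the product forces equality for `P`.
  have h1 := IsHomogeneous.le_order h
  rw [coe_mul, MvPowerSeries.order_mul, ← h.totalDegree h0, totalDegree_mul_of_isDomain hP hQ,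
    Nat.cast_add] at h1
  have h2 := order_le_totalDegree hP
  have h3 := order_le_totalDegree hQ
  generalize (P : MvPowerSeries σ R).order = a at *
  generalize (Q : MvPowerSeries σ R).order = b at *
  have ha : a ≠ ⊤ := ne_top_of_le_ne_top (ENat.natCast_ne_top _) h2
  have hb : b ≠ ⊤ := ne_top_of_le_ne_top (ENat.natCast_ne_top _) h3
  lift a to ℕ using ha
  lift b to ℕ using hb
  norm_cast at *
  omega

theorem isHomogeneous_of_dvd [IsDomain R] {P Q : MvPolynomial σ R} {n : ℕ}
    (hQ : Q.IsHomogeneous n) (h0 : Q ≠ 0) (h : P ∣ Q) : P.IsHomogeneous P.totalDegree := by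
  obtain ⟨c, rfl⟩ := h
  exact IsHomogeneous.left_of_mul hQ h0

end Order

/-! ### Multiplicities of plane curves at points. -/

section Multiplicity

variable {K : Type*} [Field K]

theorem taylorAt_mul (v : Fin 3 → K) (f g : MvPolynomial (Fin 3) K) :
    taylorAt v (f * g) = taylorAt v f * taylorAt v g := map_mul _ _ _

theorem taylorAt_ne_zero (v : Fin 3 → K) {f : MvPolynomial (Fin 3) K} (hf : f ≠ 0) :
    taylorAt v f ≠ 0 := by
  intro h
  apply hf
  -- Translating by `-v` undoes the Taylor expansion.
  have key : (aeval (fun i => X i - C (v i)) : MvPolynomial (Fin 3) K →ₐ[K] _).comp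
      (aeval (fun i => X i + C (v i))) = AlgHom.id K (MvPolynomial (Fin 3) K) := by
    ext i
    simp
  have := congrArg (aeval (fun i => X i - C (v i)) : MvPolynomial (Fin 3) K →ₐ[K] _) h
  rw [map_zero] at this
  rw [← this]
  exact (DFunLike.congr_fun key f).symm

theorem hasMultGE_iff_le_order {f : MvPolynomial (Fin 3) K} {q : Plane K} {m : ℕ} :
    HasMultGE f q m ↔ (m : ℕ∞) ≤ (taylorAt q.rep f : MvPowerSeries (Fin 3) K).order :=
  forall_homogeneousComponent_eq_zero_iff _ _

theorem order_taylorAt {f : MvPolynomial (Fin 3) K} (hf : f ≠ 0) (q : Plane K) :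
    (taylorAt q.rep f : MvPowerSeries (Fin 3) K).order = multAt f q := by
  have hT := taylorAt_ne_zero q.rep hf
  -- Nonemptiness keeps the infimum defining `multAt` from being the default value `0`.
  have hne : {k | homogeneousComponent k (taylorAt q.rep f) ≠ 0}.Nonempty := by
    by_contra hemp
    rw [Set.not_nonempty_iff_eq_empty] at hemp
    apply hT
    rw [← sum_homogeneousComponent (taylorAt q.rep f)]
    refine Finset.sum_eq_zero fun k _ => ?_
    by_contra hk
    exact (hemp ▸ hk : k ∈ (∅ : Set ℕ))
  apply le_antisymm
  · by_contra hlt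
    rw [not_le] at hlt
    have h1 : ((multAt f q + 1 : ℕ) : ℕ∞) ≤
        (taylorAt q.rep f : MvPowerSeries (Fin 3) K).order := by
      push_cast
      exact Order.add_one_le_of_lt hlt
    rw [← forall_homogeneousComponent_eq_zero_iff] at h1
    exact Nat.sInf_mem hne (h1 _ (Nat.lt_succ_self _))
  · rw [← forall_homogeneousComponent_eq_zero_iff]
    intro k hk
    by_contra hk'
    exact Nat.notMem_of_lt_sInf hk hk'

theorem hasMultGE_iff_le_multAt {f : MvPolynomial (Fin 3) K} (hf : f ≠ 0) {q : Plane K} {m : ℕ} :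
    HasMultGE f q m ↔ m ≤ multAt f q := by
  rw [hasMultGE_iff_le_order, order_taylorAt hf]
  norm_cast

theorem multAt_mul {f g : MvPolynomial (Fin 3) K} (hf : f ≠ 0) (hg : g ≠ 0) (q : Plane K) :
    multAt (f * g) q = multAt f q + multAt g q := by
  have := order_taylorAt (mul_ne_zero hf hg) q
  rw [taylorAt_mul, coe_mul, MvPowerSeries.order_mul, order_taylorAt hf, order_taylorAt hg] at this
  exact_mod_cast this.symm

theorem multAt_le_of_dvd {f g : MvPolynomial (Fin 3) K} (hg : g ≠ 0) (h : f ∣ g) (q : Plane K) :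
    multAt f q ≤ multAt g q := by
  obtain ⟨c, rfl⟩ := h
  rw [multAt_mul (left_ne_zero_of_mul hg) (right_ne_zero_of_mul hg)]
  exact Nat.le_add_right _ _

theorem totalDegree_taylorAt_le (v : Fin 3 → K) (f : MvPolynomial (Fin 3) K) :
    (taylorAt v f).totalDegree ≤ f.totalDegree := by
  classical
  have : taylorAt v f = ∑ α ∈ f.support, C (f.coeff α) * ∏ i, (X i + C (v i)) ^ α i := by
    rw [taylorAt, aeval_def, eval₂_eq']
    rfl
  rw [this]
  refine totalDegree_finsetSum_le fun α hα => ?_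
  refine (totalDegree_mul _ _).trans ?_
  rw [totalDegree_C, zero_add]
  refine (totalDegree_finsetProd _ _).trans ?_
  refine le_trans (Finset.sum_le_sum (g := fun i => α i) fun i _ => ?_) ?_
  · refine (totalDegree_pow _ _).trans ?_
    refine (Nat.mul_le_mul_left _ ((totalDegree_add _ _).trans ?_)).trans (Nat.mul_one _).le
    simp [totalDegree_X, totalDegree_C]
  · have := le_totalDegree hα
    rwa [Finsupp.sum_fintype _ _ (fun _ => rfl)] at this

/-- Puts the multiplicities of a curve of degree at most `d` inside the finite box of classes
considered in `FewEffectiveClasses`. -/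
theorem multAt_le_totalDegree {f : MvPolynomial (Fin 3) K} (hf : f ≠ 0) (q : Plane K) :
    multAt f q ≤ f.totalDegree := by
  have := order_le_totalDegree (taylorAt_ne_zero q.rep hf)
  rw [order_taylorAt hf] at this
  exact (by exact_mod_cast this : multAt f q ≤ _).trans (totalDegree_taylorAt_le _ _)

theorem HasMultGE.mono {f : MvPolynomial (Fin 3) K} {q : Plane K} {m n : ℕ} (h : HasMultGE f q n)
    (hmn : m ≤ n) : HasMultGE f q m := fun k hk => h k (hk.trans_le hmn)

end Multiplicity

/-! ### Dimensions of spaces of forms and of jets. -/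

section Dimension

variable (K : Type*) [Field K]

instance finiteDimensional_homogeneousSubmodule (t : ℕ) :
    FiniteDimensional K (homogeneousSubmodule (Fin 3) K t) :=
  Module.Finite.iff_fg.2 (homogeneousSubmodule_fg _ _ t)

theorem two_mul_finrank_homogeneousSubmodule (t : ℕ) :
    2 * Module.finrank K (homogeneousSubmodule (Fin 3) K t) = (t + 1) * (t + 2) := by
  classical
  have h1 : Module.finrank K (homogeneousSubmodule (Fin 3) K t) =
      ((Finset.univ : Finset (Fin 3)).finsuppAntidiag t).card := by
    let s : Set (Fin 3 →₀ ℕ) := ↑((Finset.univ : Finset (Fin 3)).finsuppAntidiag t)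
    have hs : {α : Fin 3 →₀ ℕ | α.degree = t} = s := by
      ext α
      simp [s, Finset.mem_finsuppAntidiag, Finsupp.degree_eq_sum]
    have e : homogeneousSubmodule (Fin 3) K t ≃ₗ[K] (s →₀ K) :=
      (LinearEquiv.ofEq _ _ ((homogeneousSubmodule_eq_finsupp_supported _ _ t).trans
        (by rw [hs]))).trans (AddMonoidAlgebra.supportedEquivFinsupp s)
    rw [e.finrank_eq, Module.finrank_finsupp_self]
    simp [s]
  rw [h1, Finset.card_finsuppAntidiag_nat_eq_choose, Finset.card_univ, Fintype.card_fin,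
    show 3 + t - 1 = t + 2 by omega, Nat.choose_symm_add, Nat.choose_two_right,
    Nat.mul_div_cancel' (Nat.even_mul_pred_self _).two_dvd]
  simp [mul_comm]

/-- The exponents of the monomials of degree less than `k` in two variables. -/
noncomputable def lowExponents (k : ℕ) : Finset (Fin 2 →₀ ℕ) :=
  (Finset.range k).biUnion fun j => (Finset.univ : Finset (Fin 2)).finsuppAntidiag j

theorem mem_lowExponents {k : ℕ} {α : Fin 2 →₀ ℕ} : α ∈ lowExponents k ↔ α.degree < k := by
  simp [lowExponents, Finset.mem_finsuppAntidiag, Finsupp.degree_eq_sum]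

theorem two_mul_card_lowExponents (k : ℕ) : 2 * (lowExponents k).card = k * (k + 1) := by
  rw [lowExponents, Finset.card_biUnion]
  · simp_rw [Finset.card_finsuppAntidiag_nat_eq_choose]
    induction k with
    | zero => simp
    | succ k ih =>
      rw [Finset.sum_range_succ, mul_add, ih]
      have : (Finset.card (Finset.univ : Finset (Fin 2)) + k - 1).choose k = k + 1 := by
        rw [Finset.card_univ, Fintype.card_fin, show 2 + k - 1 = k + 1 by omega,
          Nat.choose_succ_self_right]
      rw [this]
      ring
  · intro i _ j _ hij
    rw [Function.onFun, Finset.disjoint_left]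
    intro α hi hj
    rw [Finset.mem_finsuppAntidiag] at hi hj
    exact hij (hi.1.symm.trans hj.1)

variable {K}

/-- The map `w` factors through the image of `u`. -/
theorem finrank_range_le_of_ker_le {V W W' : Type*} [AddCommGroup V] [Module K V]
    [FiniteDimensional K V] [AddCommGroup W] [Module K W] [FiniteDimensional K W]
    [AddCommGroup W'] [Module K W'] [FiniteDimensional K W'] (u : V →ₗ[K] W) (w : V →ₗ[K] W')
    (h : LinearMap.ker u ≤ LinearMap.ker w) :
    Module.finrank K (LinearMap.range w) ≤ Module.finrank K W := by
  have h1 := u.finrank_range_add_finrank_ker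
  have h2 := w.finrank_range_add_finrank_ker
  have h3 := Submodule.finrank_mono h
  have h4 := (LinearMap.range u).finrank_le
  omega

end Dimension

/-! ### Passing from homogeneous Taylor expansions to an affine chart. -/

section LocalExpansion

variable {K : Type*} [Field K]

/-- Truncation of a polynomial in two variables to its terms of degree less than `k`. -/
noncomputable def truncation (k : ℕ) : MvPolynomial (Fin 2) K →ₗ[K] (lowExponents k → K) :=
  LinearMap.pi fun α => lcoeff K α.1

theorem truncation_eq_zero_iff {k : ℕ} {P : MvPolynomial (Fin 2) K} :
    truncation k P = 0 ↔ P ∈ idealOfVars (Fin 2) K ^ k := by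
  rw [mem_pow_idealOfVars_iff']
  constructor
  · intro h α hα
    exact congrFun h ⟨α, mem_lowExponents.2 hα⟩
  · intro h
    funext α
    exact h α.1 (mem_lowExponents.1 α.2)

theorem truncation_surjective (k : ℕ) :
    Function.Surjective (truncation k : MvPolynomial (Fin 2) K →ₗ[K] _) := by
  classical
  intro w
  refine ⟨∑ α : lowExponents k, monomial α.1 (w α), ?_⟩
  funext β
  simp only [truncation, LinearMap.pi_apply, lcoeff_apply, coeff_sum, coeff_monomial]
  rw [Finset.sum_eq_single β]
  · simp
  · intro α _ hα
    rw [if_neg fun h => hα (Subtype.ext h)]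
  · simp

/-- The expansion of a form in three variables in the affine chart `X₂ = 1`, centred at `(a, b)`. -/
noncomputable def localExpansion (a b : K) : MvPolynomial (Fin 3) K →ₐ[K] MvPolynomial (Fin 2) K :=
  aeval ![X 0 + C a, X 1 + C b, 1]

theorem localExpansion_surjective (a b : K) : Function.Surjective (localExpansion a b) := by
  intro P
  refine ⟨aeval ![X 0 - C a, X 1 - C b] P, ?_⟩
  have key : (localExpansion a b).comp (aeval ![X 0 - C a, X 1 - C b]) =
      AlgHom.id K (MvPolynomial (Fin 2) K) := by
    ext i
    fin_cases i <;> simp [localExpansion]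
  exact DFunLike.congr_fun key P

theorem aeval_C_mul_of_isHomogeneous {σ τ : Type*} {f : MvPolynomial σ K} {d : ℕ}
    (hf : f.IsHomogeneous d) (c : K) (y : σ → MvPolynomial τ K) :
    aeval (fun i => C c * y i) f = C (c ^ d) * aeval y f := by
  rw [aeval_def, aeval_def, eval₂_eq, eval₂_eq, Finset.mul_sum]
  refine Finset.sum_congr rfl fun α hα => ?_
  simp_rw [mul_pow]
  rw [Finset.prod_mul_distrib, Finset.prod_pow_eq_pow_sum]
  have : ∑ i ∈ α.support, α i = d := by
    by_contra h
    exact mem_support_iff.1 hα (hf.coeff_eq_zero h)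
  rw [this, C_pow]
  ring

theorem map_mem_pow_idealOfVars {σ τ : Type*} (ρ : MvPolynomial σ K →ₐ[K] MvPolynomial τ K)
    (hρ : ∀ i, ρ (X i) ∈ idealOfVars τ K) {P : MvPolynomial σ K} {m : ℕ}
    (hP : P ∈ idealOfVars σ K ^ m) : ρ P ∈ idealOfVars τ K ^ m := by
  have h1 : (idealOfVars σ K).map ρ ≤ idealOfVars τ K := by
    rw [Ideal.map_le_iff_le_comap, idealOfVars, Ideal.span_le]
    rintro _ ⟨i, rfl⟩
    exact hρ i
  have h2 := Ideal.mem_map_of_mem ρ hP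
  rw [Ideal.map_pow] at h2
  exact Ideal.pow_right_mono h1 m h2

theorem HasMultGE.localExpansion_mem {f : MvPolynomial (Fin 3) K} {d m : ℕ}
    (hf : f.IsHomogeneous d) {q : Plane K} (hq : q.rep 2 ≠ 0) (h : HasMultGE f q m) :
    localExpansion (q.rep 0 / q.rep 2) (q.rep 1 / q.rep 2) f ∈ idealOfVars (Fin 2) K ^ m := by
  rw [hasMultGE_iff_le_order, ← mem_pow_idealOfVars_iff_le_order] at h
  set c := q.rep 2 with hc
  -- Restricts the expansion at `q.rep` to the plane where the last coordinate is `c`, scaling the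
  -- other two variables by `c`; homogeneity then gives `c ^ d` times the chart expansion.
  let ρ : MvPolynomial (Fin 3) K →ₐ[K] MvPolynomial (Fin 2) K :=
    aeval ![C c * X 0, C c * X 1, 0]
  have hX : ∀ i, X i ∈ idealOfVars (Fin 2) K := fun i => Ideal.subset_span ⟨i, rfl⟩
  have h1 := map_mem_pow_idealOfVars ρ (fun i => by
    fin_cases i
    · simpa [ρ] using Ideal.mul_mem_left _ (C c) (hX 0)
    · simpa [ρ] using Ideal.mul_mem_left _ (C c) (hX 1)
    · simp [ρ]) h
  have h2 : ρ (taylorAt q.rep f) =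
      C (c ^ d) * localExpansion (q.rep 0 / c) (q.rep 1 / c) f := by
    rw [localExpansion, ← aeval_C_mul_of_isHomogeneous hf, taylorAt]
    have key : ρ.comp (aeval fun i => X i + C (q.rep i)) =
        aeval (fun i => C c * (![X 0 + C (q.rep 0 / c), X 1 + C (q.rep 1 / c), 1] :
          Fin 3 → MvPolynomial (Fin 2) K) i) := by
      ext i
      fin_cases i
      · simp [ρ, mul_add, ← C_mul, mul_div_cancel₀ _ hq]
      · simp [ρ, mul_add, ← C_mul, mul_div_cancel₀ _ hq]
      · simp [ρ, ← hc]
    exact DFunLike.congr_fun key f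
  rw [h2] at h1
  have h3 := Ideal.mul_mem_left _ (C (c ^ d)⁻¹) h1
  rwa [← mul_assoc, ← C_mul, inv_mul_cancel₀ (pow_ne_zero d hq), C_1, one_mul] at h3

end LocalExpansion

/-! ### Bézout's inequality with multiplicities. -/

section Bezout

variable {K : Type*} [Field K] {n : ℕ}

/-- The truncated local expansions at several points of the affine chart. -/
noncomputable def jets (a b : Fin n → K) (k : Fin n → ℕ) :
    MvPolynomial (Fin 3) K →ₗ[K] (∀ i, lowExponents (k i) → K) :=
  LinearMap.pi fun i => truncation (k i) ∘ₗ (localExpansion (a i) (b i)).toLinearMap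

theorem jets_apply (a b : Fin n → K) (k : Fin n → ℕ) (P : MvPolynomial (Fin 3) K) (i : Fin n) :
    jets a b k P i = truncation (k i) (localExpansion (a i) (b i) P) := rfl

theorem two_mul_finrank_jets (k : Fin n → ℕ) :
    2 * Module.finrank K (∀ i, lowExponents (k i) → K) = ∑ i, k i * (k i + 1) := by
  rw [Module.finrank_pi_fintype, Finset.mul_sum]
  refine Finset.sum_congr rfl fun i _ => ?_
  rw [Module.finrank_fintype_fun_eq_card, Fintype.card_coe, two_mul_card_lowExponents]

/-- Chinese remainder theorem: the `i`-th jet ideal contains a power of `X 0 - C (a i)`, and these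
powers are pairwise coprime because the abscissas differ. -/
theorem jets_surjective {a : Fin n → K} (ha : Function.Injective a) (b : Fin n → K)
    (k : Fin n → ℕ) : Function.Surjective (jets a b k) := by
  intro w
  choose Q hQ using fun i => truncation_surjective (k i) (w i)
  choose P hP using fun i => localExpansion_surjective (a i) (b i) (Q i)
  let J : Fin n → Ideal (MvPolynomial (Fin 3) K) := fun i =>
    (idealOfVars (Fin 2) K ^ k i).comap (localExpansion (a i) (b i))
  have hmem : ∀ i, (X 0 - C (a i)) ^ k i ∈ J i := by
    intro i
    rw [Ideal.mem_comap, map_pow]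
    refine Ideal.pow_mem_pow ?_ _
    have : localExpansion (a i) (b i) (X 0 - C (a i)) = X 0 := by
      simp [localExpansion]
    rw [this]
    exact Ideal.subset_span ⟨0, rfl⟩
  have hJ : Pairwise (Function.onFun IsCoprime J) := by
    intro i j hij
    have h1 : IsCoprime (X 0 - C (a i) : MvPolynomial (Fin 3) K) (X 0 - C (a j)) := by
      have h0 : a j - a i ≠ 0 := sub_ne_zero.2 fun h => hij (ha h.symm)
      refine ⟨C (a j - a i)⁻¹, -C (a j - a i)⁻¹, ?_⟩
      calc _ = C ((a j - a i)⁻¹ * (a j - a i)) := by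
            rw [C_mul, C_sub]
            ring
        _ = 1 := by rw [inv_mul_cancel₀ h0, C_1]
    obtain ⟨x, y, hxy⟩ := h1.pow (m := k i) (n := k j)
    rw [Function.onFun, Ideal.isCoprime_iff_exists]
    exact ⟨_, Ideal.mul_mem_left _ x (hmem i), _, Ideal.mul_mem_left _ y (hmem j), hxy⟩
  obtain ⟨F, hF⟩ := Ideal.exists_forall_sub_mem_ideal hJ P
  refine ⟨F, ?_⟩
  funext i
  have := hF i
  rw [Ideal.mem_comap, map_sub, hP, ← truncation_eq_zero_iff, map_sub, hQ, sub_eq_zero] at this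
  exact this

/-- Each monomial is padded with powers of `X 2`, which becomes `1` in the chart. -/
theorem exists_isHomogeneous_localExpansion_eq (P : MvPolynomial (Fin 3) K) {t : ℕ}
    (ht : P.totalDegree ≤ t) : ∃ F : MvPolynomial (Fin 3) K, F.IsHomogeneous t ∧
      ∀ a b, localExpansion a b F = localExpansion a b P := by
  refine ⟨∑ α ∈ P.support, monomial α (P.coeff α) * X 2 ^ (t - α.degree), ?_, ?_⟩
  · refine IsHomogeneous.sum _ _ _ fun α hα => ?_
    have h := (isHomogeneous_monomial (P.coeff α) (rfl : α.degree = α.degree)).mul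
      (isHomogeneous_X_pow (R := K) (2 : Fin 3) (t - α.degree))
    have h' : α.degree ≤ t := (le_totalDegree hα).trans ht
    rwa [Nat.add_sub_cancel' h'] at h
  · intro a b
    conv_rhs => rw [P.as_sum]
    rw [map_sum, map_sum]
    refine Finset.sum_congr rfl fun α _ => ?_
    have : localExpansion a b (X 2) = 1 := by simp [localExpansion]
    rw [map_mul, map_pow, this, one_pow, mul_one]

/-- In large degree the jet conditions are independent: the threshold is the largest degree among
lifts of a basis of the jet space, and combinations of these lifts are homogenised. -/
theorem exists_forall_isHomogeneous_jets_eq {a : Fin n → K} (ha : Function.Injective a)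
    (b : Fin n → K) (k : Fin n → ℕ) : ∃ t₀, ∀ t ≥ t₀, ∀ w, ∃ F : MvPolynomial (Fin 3) K,
      F.IsHomogeneous t ∧ jets a b k F = w := by
  let B := Module.finBasis K (∀ i, lowExponents (k i) → K)
  choose P hP using fun j => jets_surjective ha b k (B j)
  refine ⟨Finset.univ.sup fun j => (P j).totalDegree, fun t ht w => ?_⟩
  have hdeg : (∑ j, B.repr w j • P j).totalDegree ≤ t := by
    refine totalDegree_finsetSum_le fun j _ => (totalDegree_smul_le _ _).trans ?_
    exact (Finset.le_sup (f := fun j => (P j).totalDegree) (Finset.mem_univ j)).trans ht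
  obtain ⟨F, hF, hF'⟩ := exists_isHomogeneous_localExpansion_eq _ hdeg
  refine ⟨F, hF, ?_⟩
  have h1 : jets a b k F = jets a b k (∑ j, B.repr w j • P j) := by
    funext i
    rw [jets_apply, jets_apply, hF']
  rw [h1, map_sum]
  simp_rw [map_smul, hP]
  exact B.sum_repr w

/-- The multiplication map `(P, Q) ↦ P f + Q g` on pairs of forms. -/
noncomputable def pairing (f g : MvPolynomial (Fin 3) K) (s t : ℕ) :
    (homogeneousSubmodule (Fin 3) K s × homogeneousSubmodule (Fin 3) K t) →ₗ[K]
      MvPolynomial (Fin 3) K :=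
  (LinearMap.mulRight K f ∘ₗ (homogeneousSubmodule (Fin 3) K s).subtype).coprod
    (LinearMap.mulRight K g ∘ₗ (homogeneousSubmodule (Fin 3) K t).subtype)

theorem pairing_apply (f g : MvPolynomial (Fin 3) K) (s t : ℕ) (x) :
    pairing f g s t x = x.1.1 * f + x.2.1 * g := rfl

/-- Koszul syzygies: for coprime `f`, `g`, a relation `P f + Q g = 0` forces `P = g A` and `Q = -f
A`. -/
theorem finrank_ker_pairing_le {f g : MvPolynomial (Fin 3) K} {d e : ℕ} (hf : f.IsHomogeneous d)
    (hg : g.IsHomogeneous e) (hg0 : g ≠ 0) (hfg : IsRelPrime f g) (s : ℕ) :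
    Module.finrank K (LinearMap.ker (pairing f g (e + s) (d + s))) ≤
      Module.finrank K (homogeneousSubmodule (Fin 3) K s) := by
  let κ : homogeneousSubmodule (Fin 3) K s →ₗ[K]
      (homogeneousSubmodule (Fin 3) K (e + s) × homogeneousSubmodule (Fin 3) K (d + s)) :=
    LinearMap.prod
      ((LinearMap.mulLeft K g ∘ₗ (homogeneousSubmodule (Fin 3) K s).subtype).codRestrict _
        fun P => hg.mul P.2)
      (-(LinearMap.mulLeft K f ∘ₗ (homogeneousSubmodule (Fin 3) K s).subtype).codRestrict _
        fun P => hf.mul P.2)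
  have hle : LinearMap.ker (pairing f g (e + s) (d + s)) ≤ LinearMap.range κ := by
    rintro ⟨⟨P, hP⟩, ⟨Q, hQ⟩⟩ h
    rw [LinearMap.mem_ker, pairing_apply] at h
    simp only at h
    have hdvd : g ∣ P * f := ⟨-Q, by linear_combination h⟩
    obtain ⟨A, rfl⟩ := hfg.symm.dvd_of_dvd_mul_right hdvd
    -- The degree of `A` can be read off from that of `g * A` only if `A` is nonzero.
    by_cases hA0 : A = 0
    · subst hA0
      refine ⟨0, ?_⟩
      have hQ0 : Q = 0 := by
        have : Q * g = 0 := by linear_combination h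
        exact (mul_eq_zero.1 this).resolve_right hg0
      subst hQ0
      ext <;> simp
    · have hAh := isHomogeneous_of_dvd hP (mul_ne_zero hg0 hA0) (Dvd.intro_left g rfl)
      have hs : A.totalDegree = s := by
        have := (hg.mul hAh).inj_right hP (mul_ne_zero hg0 hA0)
        omega
      rw [hs] at hAh
      refine ⟨⟨A, hAh⟩, ?_⟩
      have hQ' : Q = -(f * A) := by
        have : (Q + f * A) * g = 0 := by linear_combination h
        exact eq_neg_of_add_eq_zero_left ((mul_eq_zero.1 this).resolve_right hg0)
      subst hQ'
      rfl
  exact (Submodule.finrank_mono hle).trans (LinearMap.finrank_range_le κ)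

/-- The Bézout inequality with multiplicities, at points of the affine chart with distinct
abscissas. -/
theorem sum_mul_le_of_localExpansion_mem {f g : MvPolynomial (Fin 3) K} {d e : ℕ}
    (hf : f.IsHomogeneous d) (hg : g.IsHomogeneous e) (hg0 : g ≠ 0) (hfg : IsRelPrime f g)
    {a : Fin n → K} (ha : Function.Injective a) (b : Fin n → K) (m k : Fin n → ℕ)
    (hm : ∀ i, localExpansion (a i) (b i) f ∈ idealOfVars (Fin 2) K ^ m i)
    (hk : ∀ i, localExpansion (a i) (b i) g ∈ idealOfVars (Fin 2) K ^ k i) :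
    ∑ i, m i * k i ≤ d * e := by
  obtain ⟨s, hs⟩ := exists_forall_isHomogeneous_jets_eq ha b (fun i => m i + k i)
  set t := d + e + s with ht
  have hst := hs t (by omega)
  let Φ := pairing f g (e + s) (d + s)
  let A := homogeneousSubmodule (Fin 3) K t
  let ψ := jets a b (fun i => m i + k i)
  have hΦA : LinearMap.range Φ ≤ A := by
    rintro _ ⟨x, rfl⟩
    have h1 := x.1.2.mul hf
    have h2 := x.2.2.mul hg
    rw [show e + s + d = t by omega] at h1
    rw [show d + s + e = t by omega] at h2
    exact h1.add h2
  have hψA : LinearMap.range (ψ.domRestrict A) = ⊤ := by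
    rw [LinearMap.range_eq_top]
    intro w
    obtain ⟨F, hF, hFw⟩ := hst w
    exact ⟨⟨F, hF⟩, hFw⟩
  have e1 := Φ.finrank_range_add_finrank_ker
  have e2 : Module.finrank K (LinearMap.ker Φ) ≤ _ := finrank_ker_pairing_le hf hg hg0 hfg s
  have e3 := (ψ.domRestrict A).finrank_range_add_finrank_ker
  rw [hψA, finrank_top] at e3
  have e4 := (ψ.domRestrict (LinearMap.range Φ)).finrank_range_add_finrank_ker
  have e5 : Module.finrank K (LinearMap.ker (ψ.domRestrict (LinearMap.range Φ))) ≤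
      Module.finrank K (LinearMap.ker (ψ.domRestrict A)) := by
    refine LinearMap.finrank_le_finrank_of_injective
      (f := (Submodule.inclusion hΦA).restrict (p := LinearMap.ker (ψ.domRestrict
        (LinearMap.range Φ))) (q := LinearMap.ker (ψ.domRestrict A)) fun x hx => hx) ?_
    intro x y hxy
    exact Subtype.ext (Subtype.ext (congrArg (fun z => z.1.1) hxy))
  -- As `f` vanishes to order `m i` and `g` to order `k i`, the jet of `P f + Q g` of order `m i + k
  -- i` depends only on the `k i`-jet of `P` and the `m i`-jet of `Q`.
  have e6 : Module.finrank K (LinearMap.range (ψ.domRestrict (LinearMap.range Φ))) ≤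
      Module.finrank K ((∀ i, lowExponents (k i) → K) × (∀ i, lowExponents (m i) → K)) := by
    have hr : LinearMap.range (ψ.domRestrict (LinearMap.range Φ)) = LinearMap.range (ψ ∘ₗ Φ) := by
      rw [LinearMap.range_domRestrict, LinearMap.range_comp]
    rw [hr]
    refine finrank_range_le_of_ker_le
      (((jets a b k) ∘ₗ (homogeneousSubmodule (Fin 3) K (e + s)).subtype).prodMap
        ((jets a b m) ∘ₗ (homogeneousSubmodule (Fin 3) K (d + s)).subtype)) _ ?_
    rintro ⟨⟨P, hP⟩, ⟨Q, hQ⟩⟩ h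
    have h1 : jets a b k P = 0 := congrArg Prod.fst h
    have h2 : jets a b m Q = 0 := congrArg Prod.snd h
    change jets a b (fun i => m i + k i) (P * f + Q * g) = 0
    funext i
    have h1i := congrFun h1 i
    have h2i := congrFun h2 i
    rw [jets_apply, Pi.zero_apply, truncation_eq_zero_iff] at h1i h2i ⊢
    rw [map_add, map_mul, map_mul, pow_add]
    refine Ideal.add_mem _ ?_ (Ideal.mul_mem_mul h2i (hk i))
    rw [mul_comm (localExpansion (a i) (b i) P)]
    exact Ideal.mul_mem_mul (hm i) h1i
  rw [Module.finrank_prod] at e1 e6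
  have d1 := two_mul_finrank_homogeneousSubmodule K (e + s)
  have d2 := two_mul_finrank_homogeneousSubmodule K (d + s)
  have d3 := two_mul_finrank_homogeneousSubmodule K s
  have d4 := two_mul_finrank_homogeneousSubmodule K t
  have j1 := two_mul_finrank_jets (K := K) m
  have j2 := two_mul_finrank_jets (K := K) k
  have j3 := two_mul_finrank_jets (K := K) (fun i => m i + k i)
  have j4 : ∑ i, (m i + k i) * (m i + k i + 1) =
      ∑ i, m i * (m i + 1) + ∑ i, k i * (k i + 1) + 2 * ∑ i, m i * k i := by
    rw [Finset.mul_sum, ← Finset.sum_add_distrib, ← Finset.sum_add_distrib]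
    exact Finset.sum_congr rfl fun i _ => by ring
  rw [ht] at d4
  change _ = Module.finrank K (homogeneousSubmodule (Fin 3) K (d + e + s)) at e3
  -- Write $h(t)=(t+1)(t+2)/2$. The range of `Φ` has dimension at least
  -- $h(e+s)+h(d+s)-h(s)=h(t)-de$. By `e3`–`e6` and `j4` it has dimension at most $h(t)-\sum
  -- m_ik_i$.
  nlinarith

end Bezout

/-- Points of the affine chart `X₂ ≠ 0` with pairwise distinct abscissas. -/
def DistinctAbscissas {K : Type*} [Field K] {n : ℕ} (p : Fin n → Plane K) : Prop :=
  (∀ i, (p i).rep 2 ≠ 0) ∧ ∀ i j, i ≠ j → (p i).rep 0 * (p j).rep 2 - (p j).rep 0 * (p i).rep 2 ≠ 0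

theorem DistinctAbscissas.injective {K : Type*} [Field K] {n : ℕ} {p : Fin n → Plane K}
    (hp : DistinctAbscissas p) : Function.Injective p := by
  intro i j hij
  by_contra hne
  exact hp.2 i j hne (by rw [hij, sub_self])

/-- The Bézout inequality with multiplicities. -/
theorem sum_multAt_mul_multAt_le {K : Type*} [Field K] {n : ℕ} {p : Fin n → Plane K}
    (hp : DistinctAbscissas p) {f g : MvPolynomial (Fin 3) K} {d e : ℕ}
    (hf : f.IsHomogeneous d) (hg : g.IsHomogeneous e) (hf0 : f ≠ 0) (hg0 : g ≠ 0)
    (hfg : IsRelPrime f g) : ∑ i, multAt f (p i) * multAt g (p i) ≤ d * e := by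
  refine sum_mul_le_of_localExpansion_mem hf hg hg0 hfg
    (a := fun i => (p i).rep 0 / (p i).rep 2) ?_ (fun i => (p i).rep 1 / (p i).rep 2) _ _
    (fun i => HasMultGE.localExpansion_mem hf (hp.1 i) ((hasMultGE_iff_le_multAt hf0).2 le_rfl))
    (fun i => HasMultGE.localExpansion_mem hg (hp.1 i) ((hasMultGE_iff_le_multAt hg0).2 le_rfl))
  intro i j hij
  by_contra hne
  have := (div_eq_div_iff (hp.1 i) (hp.1 j)).1 hij
  exact hp.2 i j hne (sub_eq_zero.2 this)

/-! ### Multihomogeneous polynomials and nonempty open sets of point tuples. -/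

section Multihomogeneous

variable {K : Type*} [Field K] {n : ℕ}

theorem IsMultihomogeneous.mul {F G : MvPolynomial (Fin n × Fin 3) K} {e e' : Fin n → ℕ}
    (hF : IsMultihomogeneous F e) (hG : IsMultihomogeneous G e') :
    IsMultihomogeneous (F * G) (e + e') :=
  fun i => (hF i).mul (hG i)

theorem isMultihomogeneous_one :
    IsMultihomogeneous (1 : MvPolynomial (Fin n × Fin 3) K) 0 :=
  fun _ => isWeightedHomogeneous_one _ _

theorem IsMultihomogeneous.prod {ι : Type*} (s : Finset ι) (F : ι → MvPolynomial (Fin n × Fin 3) K)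
    (e : ι → Fin n → ℕ) (h : ∀ j ∈ s, IsMultihomogeneous (F j) (e j)) :
    IsMultihomogeneous (∏ j ∈ s, F j) (∑ j ∈ s, e j) := by
  intro i
  rw [Finset.sum_apply]
  exact IsWeightedHomogeneous.prod s F (fun j => e j i) fun j hj => h j hj i

theorem isMultihomogeneous_X (x : Fin n × Fin 3) :
    IsMultihomogeneous (X x : MvPolynomial (Fin n × Fin 3) K) (Pi.single x.1 1) := by
  intro i
  have := isWeightedHomogeneous_X K (fun x : Fin n × Fin 3 => if x.1 = i then 1 else 0) x
  simpa [Pi.single_apply, eq_comm] using this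

theorem IsMultihomogeneous.sub {F G : MvPolynomial (Fin n × Fin 3) K} {e : Fin n → ℕ}
    (hF : IsMultihomogeneous F e) (hG : IsMultihomogeneous G e) : IsMultihomogeneous (F - G) e :=
  fun i => (weightedHomogeneousSubmodule K _ _).sub_mem (hF i) (hG i)

theorem eval_scale_of_isMultihomogeneous {F : MvPolynomial (Fin n × Fin 3) K} {e : Fin n → ℕ}
    (hF : IsMultihomogeneous F e) (c : Fin n → K) (v : Fin n × Fin 3 → K) :
    eval (fun x => c x.1 * v x) F = (∏ i, c i ^ e i) * eval v F := by
  rw [eval_eq', eval_eq', Finset.mul_sum]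
  refine Finset.sum_congr rfl fun s hs => ?_
  simp_rw [mul_pow]
  rw [Finset.prod_mul_distrib]
  have : ∏ x, c x.1 ^ s x = ∏ i, c i ^ e i := by
    rw [Fintype.prod_prod_type]
    refine Finset.prod_congr rfl fun i _ => ?_
    simp only
    rw [Finset.prod_pow_eq_pow_sum, ← hF i (mem_support_iff.1 hs), Finsupp.weight_apply,
      Finsupp.sum_fintype _ _ (by simp), Fintype.sum_prod_type]
    simp
  rw [this]
  ring

theorem exists_evalAt_ne_zero [Infinite K] {F : MvPolynomial (Fin n × Fin 3) K} {e : Fin n → ℕ}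
    (hF : IsMultihomogeneous F e) (hF0 : F ≠ 0) : ∃ p : Fin n → Plane K, evalAt p F ≠ 0 := by
  -- The extra factor makes every coordinate vector of a nonvanishing point nonzero, so that it
  -- defines a tuple in the projective plane.
  have hG0 : F * ∏ i, X (i, 2) ≠ 0 :=
    mul_ne_zero hF0 (Finset.prod_ne_zero_iff.2 fun i _ => X_ne_zero _)
  obtain ⟨v, hv⟩ : ∃ v, eval v (F * ∏ i, X (i, 2)) ≠ 0 := by
    by_contra! h
    exact hG0 (MvPolynomial.funext fun v => by rw [h v, map_zero])
  rw [map_mul, map_prod] at hv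
  have hv0 : ∀ i, (fun j => v (i, j)) ≠ 0 := by
    intro i h
    have h2 := Finset.prod_ne_zero_iff.1 (right_ne_zero_of_mul hv) i (Finset.mem_univ i)
    rw [eval_X] at h2
    exact h2 (congrFun h 2)
  choose c hc using fun i => Projectivization.exists_smul_eq_mk_rep K (fun j => v (i, j)) (hv0 i)
  refine ⟨fun i => Projectivization.mk K _ (hv0 i), ?_⟩
  have : evalAt (fun i => Projectivization.mk K _ (hv0 i)) F =
      eval (fun x => (c x.1 : K) * v x) F := by
    rw [evalAt]
    congr 2
    funext x
    rw [← hc]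
    rfl
  rw [this, eval_scale_of_isMultihomogeneous hF fun i => (c i : K)]
  exact mul_ne_zero (Finset.prod_ne_zero_iff.2 fun i _ => pow_ne_zero _ (c i).ne_zero)
    (left_ne_zero_of_mul hv)

theorem ne_zero_of_evalAt_ne_zero {p : Fin n → Plane K} {F : MvPolynomial (Fin n × Fin 3) K}
    (h : evalAt p F ≠ 0) : F ≠ 0 := by
  rintro rfl
  exact h (by simp [evalAt])

/-- To prove a statement for general points it suffices to exhibit a nonzero multihomogeneous
polynomial outside whose zero locus it holds. -/
theorem forGeneralPoints_of_ne_zero [Infinite K] {F : MvPolynomial (Fin n × Fin 3) K}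
    {e : Fin n → ℕ} (hF : IsMultihomogeneous F e) (hF0 : F ≠ 0) {P : (Fin n → Plane K) → Prop}
    (h : ∀ p, evalAt p F ≠ 0 → Function.Injective p ∧ P p) : ForGeneralPoints K n P := by
  refine ⟨{p | evalAt p F ≠ 0}, ⟨{F}, ?_, ?_⟩, exists_evalAt_ne_zero hF hF0, h⟩
  · rintro _ rfl
    exact ⟨e, hF⟩
  · ext p
    simp

end Multihomogeneous

/-! ### Taylor coefficients as polynomials in the coordinates of the points. -/

section UniversalTaylor

variable {K : Type*} [Field K] {n : ℕ}

/-- The Taylor expansion of a monomial at the `i`-th point of the universal `n`-tuple. -/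
noncomputable def universalTaylor (K : Type*) [Field K] {n : ℕ} (i : Fin n) (γ : Fin 3 →₀ ℕ) :
    MvPolynomial (Fin 3) (MvPolynomial (Fin n × Fin 3) K) :=
  ∏ j, (X j + C (X (i, j))) ^ γ j

theorem eval_coeff_universalTaylor (i : Fin n) (β γ : Fin 3 →₀ ℕ) (v : Fin n × Fin 3 → K) :
    eval v ((universalTaylor K i γ).coeff β) =
      (taylorAt (fun j => v (i, j)) (monomial γ 1)).coeff β := by
  rw [← coeff_map]
  congr 1
  rw [universalTaylor, taylorAt, aeval_monomial, map_prod, Finsupp.prod_fintype _ _ (by simp)]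
  simp

/-- All coefficients of `P` of degree `j` are weighted homogeneous of degree `ε (d - j)`. -/
def CoeffsHomogeneous {τ : Type*} (w : τ → ℕ)
    (P : MvPolynomial (Fin 3) (MvPolynomial τ K)) (ε d : ℕ) : Prop :=
  ∀ β : Fin 3 →₀ ℕ, (d < β.degree → P.coeff β = 0) ∧
    IsWeightedHomogeneous w (P.coeff β) (ε * (d - β.degree))

theorem CoeffsHomogeneous.mul {τ : Type*} {w : τ → ℕ} {ε d d' : ℕ}
    {P Q : MvPolynomial (Fin 3) (MvPolynomial τ K)} (hP : CoeffsHomogeneous w P ε d)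
    (hQ : CoeffsHomogeneous w Q ε d') : CoeffsHomogeneous w (P * Q) ε (d + d') := by
  classical
  intro β
  rw [coeff_mul]
  -- Terms for which one of the truncated subtractions would lose information vanish.
  have key : ∀ x ∈ Finset.HasAntidiagonal.antidiagonal β, (d < x.1.degree ∨ d' < x.2.degree) →
      P.coeff x.1 * Q.coeff x.2 = 0 := by
    rintro x _ (h | h)
    · rw [(hP x.1).1 h, zero_mul]
    · rw [(hQ x.2).1 h, mul_zero]
  have hdeg : ∀ x ∈ Finset.HasAntidiagonal.antidiagonal β, x.1.degree + x.2.degree = β.degree := by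
    intro x hx
    rw [← map_add, Finset.HasAntidiagonal.mem_antidiagonal.1 hx]
  constructor
  · intro hβ
    refine Finset.sum_eq_zero fun x hx => key x hx ?_
    have := hdeg x hx
    omega
  · refine IsWeightedHomogeneous.sum _ _ _ fun x hx => ?_
    by_cases h : d < x.1.degree ∨ d' < x.2.degree
    · rw [key x hx h]
      exact isWeightedHomogeneous_zero _ _ _
    · have h1 := (hP x.1).2.mul (hQ x.2).2
      have := hdeg x hx
      rwa [← mul_add, show d - x.1.degree + (d' - x.2.degree) = d + d' - β.degree by omega] at h1

theorem coeffsHomogeneous_one {τ : Type*} (w : τ → ℕ) (ε : ℕ) :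
    CoeffsHomogeneous w (1 : MvPolynomial (Fin 3) (MvPolynomial τ K)) ε 0 := by
  classical
  intro β
  rw [coeff_one]
  split_ifs with h
  · subst h
    exact ⟨by simp, by simpa using isWeightedHomogeneous_one K w⟩
  · exact ⟨fun _ => rfl, isWeightedHomogeneous_zero _ _ _⟩

theorem CoeffsHomogeneous.pow {τ : Type*} {w : τ → ℕ} {ε : ℕ}
    {P : MvPolynomial (Fin 3) (MvPolynomial τ K)} (hP : CoeffsHomogeneous w P ε 1) (k : ℕ) :
    CoeffsHomogeneous w (P ^ k) ε k := by
  induction k with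
  | zero => simpa using coeffsHomogeneous_one w ε
  | succ k ih => exact pow_succ P k ▸ ih.mul hP

theorem coeffsHomogeneous_X_add_C (i i' : Fin n) (j : Fin 3) :
    CoeffsHomogeneous (fun x : Fin n × Fin 3 => if x.1 = i' then 1 else 0)
      (X j + C (X (i, j)) : MvPolynomial (Fin 3) (MvPolynomial (Fin n × Fin 3) K))
      (if i = i' then 1 else 0) 1 := by
  classical
  intro β
  rw [coeff_add, coeff_X, coeff_C]
  by_cases h1 : Finsupp.single j 1 = β
  · subst h1
    rw [if_pos rfl, if_neg (by simp [eq_comm]), add_zero, Finsupp.degree_single]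
    exact ⟨by simp, by simpa using isWeightedHomogeneous_one K _⟩
  · rw [if_neg h1, zero_add]
    by_cases h2 : 0 = β
    · subst h2
      have h3 := isWeightedHomogeneous_X K
        (fun x : Fin n × Fin 3 => if x.1 = i' then 1 else 0) (i, j)
      exact ⟨by simp, by simpa using h3⟩
    · rw [if_neg h2]
      exact ⟨fun _ => rfl, isWeightedHomogeneous_zero _ _ _⟩

/-- Each of the `γ.degree` linear factors contributes either a variable or a coordinate of the
`i`-th point; a coefficient of exponent `β` uses `γ.degree - β.degree` coordinates and none of
another point. -/
theorem isMultihomogeneous_coeff_universalTaylor (i : Fin n) (β γ : Fin 3 →₀ ℕ) :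
    IsMultihomogeneous ((universalTaylor K i γ).coeff β)
      (fun i' => (if i = i' then 1 else 0) * (γ.degree - β.degree)) := by
  intro i'
  have h : CoeffsHomogeneous (fun x : Fin n × Fin 3 => if x.1 = i' then 1 else 0)
      (universalTaylor K i γ) (if i = i' then 1 else 0) γ.degree := by
    rw [universalTaylor, Finsupp.degree_eq_sum, Fin.prod_univ_three, Fin.sum_univ_three]
    exact (((coeffsHomogeneous_X_add_C i i' 0).pow _).mul
      ((coeffsHomogeneous_X_add_C i i' 1).pow _)).mul ((coeffsHomogeneous_X_add_C i i' 2).pow _)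
  exact (h β).2

end UniversalTaylor

/-! ### Emptiness of a linear system as nonvanishing of a minor. -/

section Minors

variable {K : Type*} [Field K] {n : ℕ}

/-- The exponents of the monomials of degree `a` in three variables. -/
noncomputable abbrev formExponents (a : ℕ) : Finset (Fin 3 →₀ ℕ) :=
  (Finset.univ : Finset (Fin 3)).finsuppAntidiag a

theorem mem_formExponents {a : ℕ} {γ : Fin 3 →₀ ℕ} : γ ∈ formExponents a ↔ γ.degree = a := by
  simp [Finset.mem_finsuppAntidiag, Finsupp.degree_eq_sum]

/-- The form with given coefficients. -/
noncomputable def formOfCoeffs {a : ℕ} (c : formExponents a → K) : MvPolynomial (Fin 3) K :=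
  ∑ γ, monomial γ.1 (c γ)

theorem isHomogeneous_formOfCoeffs {a : ℕ} (c : formExponents a → K) :
    (formOfCoeffs c).IsHomogeneous a :=
  IsHomogeneous.sum _ _ _ fun γ _ => isHomogeneous_monomial _ (mem_formExponents.1 γ.2)

theorem coeff_formOfCoeffs {a : ℕ} (c : formExponents a → K) (γ : formExponents a) :
    (formOfCoeffs c).coeff γ.1 = c γ := by
  classical
  rw [formOfCoeffs, coeff_sum, Finset.sum_eq_single γ]
  · simp
  · intro γ' _ h
    rw [coeff_monomial, if_neg fun h' => h (Subtype.ext h')]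
  · simp

theorem formOfCoeffs_coeff {a : ℕ} {f : MvPolynomial (Fin 3) K} (hf : f.IsHomogeneous a) :
    formOfCoeffs (fun γ : formExponents a => f.coeff γ.1) = f := by
  ext γ
  by_cases h : γ.degree = a
  · exact coeff_formOfCoeffs _ ⟨γ, mem_formExponents.2 h⟩
  · rw [hf.coeff_eq_zero h, (isHomogeneous_formOfCoeffs _).coeff_eq_zero h]

/-- The value at `p` of the condition on forms of degree `a` given by the coefficient of exponent
`β` in the Taylor expansion at the `i`-th point. -/
noncomputable def conditionRow (p : Fin n → Plane K) (a : ℕ) (x : Fin n × (Fin 3 →₀ ℕ)) :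
    formExponents a → K :=
  fun γ => evalAt p ((universalTaylor K x.1 γ.1).coeff x.2)

theorem coeff_taylorAt_formOfCoeffs (p : Fin n → Plane K) {a : ℕ} (c : formExponents a → K)
    (x : Fin n × (Fin 3 →₀ ℕ)) :
    (taylorAt (p x.1).rep (formOfCoeffs c)).coeff x.2 = ∑ γ, conditionRow p a x γ * c γ := by
  rw [formOfCoeffs, taylorAt, map_sum, coeff_sum]
  refine Finset.sum_congr rfl fun γ _ => ?_
  rw [conditionRow, evalAt, eval_coeff_universalTaylor]
  have : (monomial γ.1 (c γ) : MvPolynomial (Fin 3) K) = c γ • monomial γ.1 1 := by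
    rw [smul_monomial, smul_eq_mul, mul_one]
  rw [this, map_smul, coeff_smul, smul_eq_mul, mul_comm]
  rfl

theorem formOfCoeffs_mem_linearSystem_iff (p : Fin n → Plane K) {a : ℕ} (α : Fin n → ℕ)
    (c : formExponents a → K) :
    formOfCoeffs c ∈ linearSystem p a α ↔
      ∀ x : Fin n × (Fin 3 →₀ ℕ), x.2.degree < α x.1 → ∑ γ, conditionRow p a x γ * c γ = 0 := by
  have h : formOfCoeffs c ∈ linearSystem p a α ↔ ∀ i, HasMultGE (formOfCoeffs c) (p i) (α i) :=
    ⟨fun h => h.2, fun h => ⟨isHomogeneous_formOfCoeffs c, h⟩⟩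
  simp only [h, hasMultGE_iff_le_order, ← mem_pow_idealOfVars_iff_le_order,
    mem_pow_idealOfVars_iff']
  constructor
  · intro h x hx
    rw [← coeff_taylorAt_formOfCoeffs]
    exact h x.1 x.2 hx
  · intro h i β hβ
    exact (coeff_taylorAt_formOfCoeffs p c (i, β)).trans (h (i, β) hβ)

/-- Rows with no common nonzero solution span the whole space, since a functional killing them all
would be such a solution; a basis chosen among them gives a nonsingular square matrix. -/
theorem exists_det_ne_zero_of_forall_dot_eq_zero {ι N : Type*} [Fintype N] [DecidableEq N]
    (R : ι → N → K) (s : Set ι)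
    (h : ∀ c : N → K, (∀ x ∈ s, ∑ γ, R x γ * c γ = 0) → c = 0) :
    ∃ ρ : N → ι, (∀ j, ρ j ∈ s) ∧ (Matrix.of fun j => R (ρ j)).det ≠ 0 := by
  have hspan : Submodule.span K (R '' s) = ⊤ := by
    by_contra hne
    obtain ⟨φ, hφ, hle⟩ := Submodule.exists_le_ker_of_lt_top _ (lt_top_iff_ne_top.2 hne)
    apply hφ
    have hφ' : ∀ y : N → K, φ y = ∑ γ, y γ * φ (Pi.single γ 1) := by
      intro y
      conv_lhs => rw [← Finset.univ_sum_single y, map_sum]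
      refine Finset.sum_congr rfl fun γ _ => ?_
      rw [← smul_eq_mul, ← map_smul, ← Pi.single_smul, smul_eq_mul, mul_one]
    have h0 := h (fun γ => φ (Pi.single γ 1)) fun x hx => by
      rw [← hφ']
      exact hle (Submodule.subset_span ⟨x, hx, rfl⟩)
    ext γ
    simpa using congrFun h0 γ
  obtain ⟨b, hbs, hb, hli⟩ := exists_linearIndependent K (R '' s)
  rw [hspan] at hb
  let B : Module.Basis b K (N → K) := Module.Basis.mk hli (by rw [Subtype.range_coe, hb])
  let e : b ≃ N := B.indexEquiv (Pi.basisFun K N)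
  choose ρ hρ hρR using fun j => hbs (e.symm j).2
  refine ⟨ρ, hρ, ?_⟩
  have hrow : (fun j => R (ρ j)) = fun j => ((e.symm j : b) : N → K) := funext hρR
  have hli' : LinearIndependent K (Matrix.of fun j => R (ρ j)).row := by
    change LinearIndependent K fun j => R (ρ j)
    rw [hrow]
    exact hli.comp _ e.symm.injective
  exact ((Matrix.isUnit_iff_isUnit_det _).1
    (Matrix.linearIndependent_rows_iff_isUnit.1 hli')).ne_zero

/-- Emptiness of a linear system is an open condition on the points. -/
theorem exists_isMultihomogeneous_of_linearSystem_eq_bot {p₀ : Fin n → Plane K} {a : ℕ}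
    {α : Fin n → ℕ} (h : linearSystem p₀ a α = ⊥) :
    ∃ F : MvPolynomial (Fin n × Fin 3) K, (∃ e, IsMultihomogeneous F e) ∧ F ≠ 0 ∧
      ∀ p, evalAt p F ≠ 0 → linearSystem p a α = ⊥ := by
  classical
  obtain ⟨ρ, hρ, hdet⟩ := exists_det_ne_zero_of_forall_dot_eq_zero (conditionRow p₀ a)
    {x | x.2.degree < α x.1} fun c hc => by
      have h1 := (formOfCoeffs_mem_linearSystem_iff p₀ α c).2 hc
      rw [h, Submodule.mem_bot] at h1
      funext γ
      rw [← coeff_formOfCoeffs c γ, h1]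
      rfl
  -- The chosen rows with universal points; its determinant specialises at `p` to the minor of
  -- conditions there.
  let M : Matrix (formExponents a) (formExponents a) (MvPolynomial (Fin n × Fin 3) K) :=
    Matrix.of fun j γ => (universalTaylor K (ρ j).1 γ.1).coeff (ρ j).2
  have heval : ∀ p, evalAt p M.det = (Matrix.of fun j => conditionRow p a (ρ j)).det := by
    intro p
    rw [evalAt, RingHom.map_det]
    rfl
  refine ⟨M.det, ⟨∑ j, fun i' => (if (ρ j).1 = i' then 1 else 0) * (a - (ρ j).2.degree), ?_⟩,
    ne_zero_of_evalAt_ne_zero (p := p₀) (by rwa [heval]), fun p hp => ?_⟩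
  -- After transposing, each product runs over the rows `j`. All columns have exponent degree `a`,
  -- so the multidegree does not depend on the permutation.
  · rw [← Matrix.det_transpose, Matrix.det_apply]
    intro i
    refine IsWeightedHomogeneous.sum _ _ _ fun τ _ => ?_
    refine (weightedHomogeneousSubmodule K _ _).toAddSubgroup.zsmul_mem ?_ _
    refine IsMultihomogeneous.prod _ _ _ (fun j _ => ?_) i
    have := isMultihomogeneous_coeff_universalTaylor (K := K) (ρ j).1 (ρ j).2 (τ j).1
    rwa [mem_formExponents.1 (τ j).2] at this
  · rw [heval] at hp
    rw [eq_bot_iff]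
    intro f hf
    have hfh := hf.1
    rw [← formOfCoeffs_coeff hfh, formOfCoeffs_mem_linearSystem_iff] at hf
    have h0 : (fun γ : formExponents a => f.coeff γ.1) = 0 := by
      by_contra hne
      exact hp (Matrix.exists_mulVec_eq_zero_iff.1 ⟨_, hne, funext fun j => hf (ρ j) (hρ j)⟩)
    rw [Submodule.mem_bot, ← formOfCoeffs_coeff hfh, h0]
    simp [formOfCoeffs]

end Minors

/-! ### The general position conditions. -/

section GeneralPosition

variable {K : Type*} [Field K] {n : ℕ}

/-- Among the classes of degree and multiplicities at most `d`, only those that are effective for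
all choices of the points are effective at `p`. -/
def FewEffectiveClasses (p : Fin n → Plane K) (d : ℕ) : Prop :=
  ∀ a ≤ d, ∀ α : Fin n → ℕ, (∀ i, α i ≤ d) → linearSystem p a α ≠ ⊥ →
    ∀ p' : Fin n → Plane K, linearSystem p' a α ≠ ⊥

/-- The box holds finitely many classes. Each one that is empty for some tuple contributes a nonzero
polynomial whose nonvanishing keeps it empty; multiplying these with the conditions for distinct
abscissas defines the open set. -/
theorem forGeneralPoints_of_generalPosition [Infinite K] (d : ℕ) {P : (Fin n → Plane K) → Prop}
    (h : ∀ p, DistinctAbscissas p → FewEffectiveClasses p d → P p) : ForGeneralPoints K n P := by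
  classical
  have hbox : ∀ x : Fin (d + 1) × (Fin n → Fin (d + 1)), ∃ F : MvPolynomial (Fin n × Fin 3) K,
      (∃ e, IsMultihomogeneous F e) ∧ F ≠ 0 ∧ ∀ p, evalAt p F ≠ 0 →
        linearSystem p x.1 (fun i => x.2 i) ≠ ⊥ →
          ∀ p' : Fin n → Plane K, linearSystem p' x.1 (fun i => x.2 i) ≠ ⊥ := by
    intro x
    by_cases hx : ∀ p' : Fin n → Plane K, linearSystem p' x.1 (fun i => x.2 i) ≠ ⊥
    · exact ⟨1, ⟨0, isMultihomogeneous_one⟩, one_ne_zero, fun _ _ _ => hx⟩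
    · push Not at hx
      obtain ⟨p₀, hp₀⟩ := hx
      obtain ⟨F, hF, hF0, hFp⟩ := exists_isMultihomogeneous_of_linearSystem_eq_bot hp₀
      exact ⟨F, hF, hF0, fun p hp hne => absurd (hFp p hp) hne⟩
  choose F hF hF0 hFp using hbox
  choose e he using hF
  let D : Fin n × Fin n → MvPolynomial (Fin n × Fin 3) K := fun x =>
    if x.1 = x.2 then X (x.1, 2) else X (x.1, 0) * X (x.2, 2) - X (x.2, 0) * X (x.1, 2)
  have hD : ∀ x, IsMultihomogeneous (D x)
      (if x.1 = x.2 then Pi.single x.1 1 else Pi.single x.1 1 + Pi.single x.2 1) := by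
    intro x
    simp only [D]
    split_ifs with hx
    · exact isMultihomogeneous_X (x.1, 2)
    · refine ((isMultihomogeneous_X (x.1, 0)).mul (isMultihomogeneous_X (x.2, 2))).sub ?_
      rw [add_comm]
      exact (isMultihomogeneous_X (x.2, 0)).mul (isMultihomogeneous_X (x.1, 2))
  have hD0 : ∀ x, D x ≠ 0 := by
    intro x
    simp only [D]
    split_ifs with hx
    · exact X_ne_zero _
    · intro h0
      have := congrArg (eval fun y => if y = (x.1, 0) ∨ y = (x.2, 2) then (1 : K) else 0) h0
      simp [Prod.ext_iff, hx, Ne.symm hx] at this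
  refine forGeneralPoints_of_ne_zero
    ((IsMultihomogeneous.prod Finset.univ F e fun x _ => he x).mul
      (IsMultihomogeneous.prod Finset.univ D _ fun x _ => hD x))
    (mul_ne_zero (Finset.prod_ne_zero_iff.2 fun x _ => hF0 x)
      (Finset.prod_ne_zero_iff.2 fun x _ => hD0 x)) fun p hp => ?_
  rw [evalAt, map_mul, map_prod, map_prod] at hp
  have h1 := Finset.prod_ne_zero_iff.1 (left_ne_zero_of_mul hp)
  have h2 := Finset.prod_ne_zero_iff.1 (right_ne_zero_of_mul hp)
  have hdist : DistinctAbscissas p := by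
    refine ⟨fun i => ?_, fun i j hij => ?_⟩
    · simpa [D] using h2 (i, i) (Finset.mem_univ _)
    · simpa [D, hij] using h2 (i, j) (Finset.mem_univ _)
  refine ⟨hdist.injective, h p hdist fun a ha α hα => ?_⟩
  exact hFp (⟨a, Nat.lt_succ_of_le ha⟩, fun i => ⟨α i, Nat.lt_succ_of_le (hα i)⟩) p
    (h1 _ (Finset.mem_univ _))

theorem linearSystem_comp_perm (p : Fin n → Plane K) (a : ℕ) (α : Fin n → ℕ)
    (τ : Equiv.Perm (Fin n)) : linearSystem (p ∘ τ) a (α ∘ τ) = linearSystem p a α := by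
  ext f
  exact and_congr_right fun _ => τ.forall_congr_right (q := fun i => HasMultGE f (p i) (α i))

/-- Permuting multiplicities amounts to permuting points in the opposite direction, and effectivity
in the box does not depend on the points. -/
theorem FewEffectiveClasses.linearSystem_perm_ne_bot {p : Fin n → Plane K} {d a : ℕ}
    (hp : FewEffectiveClasses p d) (ha : a ≤ d) {α : Fin n → ℕ} (hα : ∀ i, α i ≤ d)
    (h : linearSystem p a α ≠ ⊥) (τ : Equiv.Perm (Fin n)) : linearSystem p a (α ∘ τ) ≠ ⊥ := by
  have h1 := hp a ha α hα h (p ∘ τ.symm)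
  rw [← linearSystem_comp_perm _ _ _ τ, Function.comp_assoc] at h1
  simpa using h1

end GeneralPosition

/-! ### The intersection form. -/

section IntersectionForm

variable {n : ℕ}

theorem inter_comm (a b : PicClass n) : inter a b = inter b a := by
  simp only [inter, mul_comm]

theorem inter_add_right (a b c : PicClass n) : inter a (b + c) = inter a b + inter a c := by
  simp only [inter, Prod.fst_add, Prod.snd_add, Pi.add_apply, mul_add, Finset.sum_add_distrib]
  ring

theorem inter_add_left (a b c : PicClass n) : inter (a + b) c = inter a c + inter b c := by
  rw [inter_comm, inter_add_right, inter_comm c, inter_comm c]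

/-- Linear systems only bound multiplicities from below; this passes from the prescribed class to
that of an actual member. -/
theorem inter_le_inter_right {a b c : PicClass n} (ha : ∀ i, 0 ≤ a.2 i) (hbc : b.1 = c.1)
    (h : ∀ i, c.2 i ≤ b.2 i) : inter a b ≤ inter a c := by
  simp only [inter, hbc]
  have := Finset.sum_le_sum fun (i : Fin n) (_ : i ∈ Finset.univ) =>
    mul_le_mul_of_nonneg_left (h i) (ha i)
  linarith

end IntersectionForm

/-! ### Classes of forms: negative curves, permutations and disjointness. -/

section FormClass

variable {K : Type*} [Field K] {n : ℕ}

/-- The class of the strict transform of the curve `f = 0`. -/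
noncomputable def formClass (p : Fin n → Plane K) (f : MvPolynomial (Fin 3) K) : PicClass n :=
  ((f.totalDegree : ℤ), fun i => (multAt f (p i) : ℤ))

theorem formClass_mul (p : Fin n → Plane K) {f g : MvPolynomial (Fin 3) K} (hf : f ≠ 0)
    (hg : g ≠ 0) : formClass p (f * g) = formClass p f + formClass p g := by
  ext i
  · simp [formClass, totalDegree_mul_of_isDomain hf hg]
  · simp [formClass, multAt_mul hf hg]

theorem formClass_eq_zero_of_totalDegree_eq_zero (p : Fin n → Plane K)
    {f : MvPolynomial (Fin 3) K} (hf : f ≠ 0) (h : f.totalDegree = 0) : formClass p f = 0 := by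
  ext i
  · simp [formClass, h]
  · have := multAt_le_totalDegree hf (p i)
    simp [formClass]
    omega

theorem isUnit_of_totalDegree_eq_zero {f : MvPolynomial (Fin 3) K} (hf : f ≠ 0)
    (h : f.totalDegree = 0) : IsUnit f := by
  rw [totalDegree_eq_zero_iff_eq_C] at h
  rw [h]
  refine (IsUnit.mk0 _ fun h0 => hf ?_).map C
  rw [h, h0, C_0]

theorem totalDegree_eq_zero_of_isUnit {f : MvPolynomial (Fin 3) K} (h : IsUnit f) :
    f.totalDegree = 0 := by
  have := totalDegree_le_of_dvd_of_isDomain (isUnit_iff_dvd_one.1 h) one_ne_zero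
  simpa using this

theorem dvd_of_dvd_of_totalDegree_le {f h : MvPolynomial (Fin 3) K} (h0 : h ≠ 0) (hfh : f ∣ h)
    (hdeg : h.totalDegree ≤ f.totalDegree) : h ∣ f := by
  obtain ⟨c, rfl⟩ := hfh
  have hf := left_ne_zero_of_mul h0
  have hc := right_ne_zero_of_mul h0
  rw [totalDegree_mul_of_isDomain hf hc] at hdeg
  exact (isUnit_of_totalDegree_eq_zero hc (by omega)).mul_right_dvd.2 dvd_rfl

theorem formClass_eq_of_dvd_of_dvd (p : Fin n → Plane K) {f g : MvPolynomial (Fin 3) K}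
    (hf : f ≠ 0) (hg : g ≠ 0) (h1 : f ∣ g) (h2 : g ∣ f) : formClass p f = formClass p g := by
  ext i
  · exact congrArg Nat.cast ((totalDegree_le_of_dvd_of_isDomain h1 hg).antisymm
      (totalDegree_le_of_dvd_of_isDomain h2 hf))
  · exact congrArg Nat.cast ((multAt_le_of_dvd hg h1 _).antisymm (multAt_le_of_dvd hf h2 _))

/-- `f` is a form in three variables that defines an irreducible curve. -/
def IsIrreducibleForm (f : MvPolynomial (Fin 3) K) : Prop :=
  Irreducible f ∧ f.IsHomogeneous f.totalDegree

theorem IsIrreducibleForm.ne_zero {f : MvPolynomial (Fin 3) K} (hf : IsIrreducibleForm f) :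
    f ≠ 0 := hf.1.ne_zero

theorem IsIrreducibleForm.totalDegree_pos {f : MvPolynomial (Fin 3) K}
    (hf : IsIrreducibleForm f) : 0 < f.totalDegree :=
  Nat.pos_of_ne_zero fun h => hf.1.not_isUnit (isUnit_of_totalDegree_eq_zero hf.ne_zero h)

variable {p : Fin n → Plane K}

theorem DistinctAbscissas.inter_nonneg (hp : DistinctAbscissas p) {f g : MvPolynomial (Fin 3) K}
    (hf : IsIrreducibleForm f) (hg : g.IsHomogeneous g.totalDegree) (hg0 : g ≠ 0)
    (hfg : ¬ f ∣ g) : 0 ≤ inter (formClass p f) (formClass p g) := by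
  have := sum_multAt_mul_multAt_le hp hf.2 hg hf.ne_zero hg0
    (hf.1.isRelPrime_iff_not_dvd.2 hfg)
  simp only [inter, formClass, sub_nonneg]
  exact_mod_cast this

/-- Multiplicities of `g` beyond the prescribed ones only lower the intersection number, so Bézout
makes `f` a component of every member. -/
theorem DistinctAbscissas.dvd_of_inter_neg (hp : DistinctAbscissas p)
    {f g : MvPolynomial (Fin 3) K} (hf : IsIrreducibleForm f) {a : ℕ} {α : Fin n → ℕ}
    (hg : g ∈ linearSystem p a α)
    (h : inter (formClass p f) ((a : ℤ), fun i => (α i : ℤ)) < 0) : f ∣ g := by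
  by_cases hg0 : g = 0
  · exact hg0 ▸ dvd_zero f
  by_contra hfg
  have hdeg := hg.1.totalDegree hg0
  have h1 := hp.inter_nonneg hf (by rw [hdeg]; exact hg.1) hg0 hfg
  refine absurd (h1.trans (inter_le_inter_right (fun i => ?_) ?_ fun i => ?_)) (not_le.2 h)
  · exact Nat.cast_nonneg _
  · exact congrArg Nat.cast hdeg
  · exact Nat.cast_le.2 ((hasMultGE_iff_le_multAt hg0).1 (hg.2 i))

theorem mem_linearSystem_multAt {g : MvPolynomial (Fin 3) K} (hg : g.IsHomogeneous g.totalDegree)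
    (hg0 : g ≠ 0) : g ∈ linearSystem p g.totalDegree (fun i => multAt g (p i)) :=
  ⟨hg, fun _ => (hasMultGE_iff_le_multAt hg0).2 le_rfl⟩

theorem FewEffectiveClasses.exists_perm {d : ℕ} (hp : FewEffectiveClasses p d)
    {h : MvPolynomial (Fin 3) K} (hh : h.IsHomogeneous h.totalDegree) (h0 : h ≠ 0)
    (hd : h.totalDegree ≤ d) (τ : Equiv.Perm (Fin n)) :
    ∃ g ∈ linearSystem p h.totalDegree (fun i => multAt h (p (τ i))), g ≠ 0 := by
  have hne : linearSystem p h.totalDegree (fun i => multAt h (p i)) ≠ ⊥ :=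
    (Submodule.ne_bot_iff _).2 ⟨h, mem_linearSystem_multAt hh h0, h0⟩
  exact (Submodule.ne_bot_iff _).1
    (hp.linearSystem_perm_ne_bot hd (fun i => (multAt_le_totalDegree h0 _).trans hd) hne τ)

/-- Take a form `g` in the permuted class. If `g` factors, permuting the classes of its factors back
gives forms whose product lies in the system of `f`, hence is divisible by `f` because $f^2<0$. As
`f` is prime it divides one of them, and degrees make the other factor of `g` constant. Permuting
the class of `g` itself back gives a multiple of `f` of the same degree, so `g` has no excess
multiplicity. -/
theorem exists_isIrreducibleForm_perm {d : ℕ} (hp : DistinctAbscissas p)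
    (hfew : FewEffectiveClasses p d) {f : MvPolynomial (Fin 3) K} (hf : IsIrreducibleForm f)
    (hd : f.totalDegree ≤ d) (hneg : inter (formClass p f) (formClass p f) < 0)
    (τ : Equiv.Perm (Fin n)) : ∃ g, IsIrreducibleForm g ∧
      formClass p g = ((f.totalDegree : ℤ), fun i => (multAt f (p (τ i)) : ℤ)) := by
  obtain ⟨g, hg, hg0⟩ := hfew.exists_perm hf.2 hf.ne_zero hd τ
  have hgdeg : g.totalDegree = f.totalDegree := hg.1.totalDegree hg0
  have hgh : g.IsHomogeneous g.totalDegree := by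
    rw [hgdeg]
    exact hg.1
  have hgmult : ∀ i, multAt f (p (τ i)) ≤ multAt g (p i) := fun i =>
    (hasMultGE_iff_le_multAt hg0).1 (hg.2 i)
  have hdvd : ∀ h ∈ linearSystem p f.totalDegree (fun i => multAt g (p (τ.symm i))), f ∣ h := by
    intro h hh
    refine hp.dvd_of_inter_neg hf (a := f.totalDegree) (α := fun i => multAt f (p i))
      ⟨hh.1, fun i => (hh.2 i).mono ?_⟩ hneg
    simpa using hgmult (τ.symm i)
  refine ⟨g, ⟨⟨?_, ?_⟩, hgh⟩, ?_⟩
  · intro hu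
    have h1 := totalDegree_eq_zero_of_isUnit hu
    have h2 := hf.totalDegree_pos
    omega
  · intro g₁ g₂ hmul
    have h12 : g₁ * g₂ ≠ 0 := hmul ▸ hg0
    have h1 := left_ne_zero_of_mul h12
    have h2 := right_ne_zero_of_mul h12
    have hdeg : g₁.totalDegree + g₂.totalDegree = f.totalDegree := by
      rw [← totalDegree_mul_of_isDomain h1 h2, ← hmul, hgdeg]
    have hh1 := isHomogeneous_of_dvd hgh hg0 (hmul ▸ Dvd.intro _ rfl : g₁ ∣ g)
    have hh2 := isHomogeneous_of_dvd hgh hg0 (hmul ▸ Dvd.intro_left _ rfl : g₂ ∣ g)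
    obtain ⟨k₁, hk₁, hk₁0⟩ := hfew.exists_perm hh1 h1 (by omega) τ.symm
    obtain ⟨k₂, hk₂, hk₂0⟩ := hfew.exists_perm hh2 h2 (by omega) τ.symm
    have hk : f ∣ k₁ * k₂ := by
      refine hdvd _ ⟨hdeg ▸ hk₁.1.mul hk₂.1, fun i => ?_⟩
      rw [hasMultGE_iff_le_multAt (mul_ne_zero hk₁0 hk₂0), multAt_mul hk₁0 hk₂0, hmul]
      beta_reduce
      rw [multAt_mul h1 h2]
      exact add_le_add ((hasMultGE_iff_le_multAt hk₁0).1 (hk₁.2 i))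
        ((hasMultGE_iff_le_multAt hk₂0).1 (hk₂.2 i))
    rcases hf.1.prime.dvd_or_dvd hk with h | h
    · right
      have := totalDegree_le_of_dvd_of_isDomain h hk₁0
      rw [hk₁.1.totalDegree hk₁0] at this
      exact isUnit_of_totalDegree_eq_zero h2 (by omega)
    · left
      have := totalDegree_le_of_dvd_of_isDomain h hk₂0
      rw [hk₂.1.totalDegree hk₂0] at this
      exact isUnit_of_totalDegree_eq_zero h1 (by omega)
  · obtain ⟨h, hh, hh0⟩ := hfew.exists_perm hgh hg0 (hgdeg ▸ hd) τ.symm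
    have hhdeg := hh.1.totalDegree hh0
    rw [hgdeg] at hh hhdeg
    have hhf := dvd_of_dvd_of_totalDegree_le hh0 (hdvd h hh) hhdeg.le
    ext i
    · exact congrArg Nat.cast hgdeg
    · refine congrArg Nat.cast ((le_antisymm ?_ (hgmult i)) : multAt g (p i) = multAt f (p (τ i)))
      have h1 := (hasMultGE_iff_le_multAt hh0).1 (hh.2 (τ i))
      beta_reduce at h1
      rw [Equiv.symm_apply_apply] at h1
      exact h1.trans (multAt_le_of_dvd hf.ne_zero hhf _)

/-- Otherwise Bézout would make the product of the two classes nonnegative, but it equals the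
negative self-intersection. -/
theorem DistinctAbscissas.dvd_of_formClass_eq (hp : DistinctAbscissas p)
    {f g : MvPolynomial (Fin 3) K} (hf : IsIrreducibleForm f) (hg : IsIrreducibleForm g)
    (h : formClass p f = formClass p g)
    (hneg : inter (formClass p f) (formClass p f) < 0) : f ∣ g := by
  by_contra hfg
  have := hp.inter_nonneg hf hg.2 hg.ne_zero hfg
  rw [← h] at this
  omega

/-- A sum of two curves that meets both of them nonnegatively is nef. -/
theorem DistinctAbscissas.inter_add_nonneg (hp : DistinctAbscissas p)
    {f g : MvPolynomial (Fin 3) K} (hf : IsIrreducibleForm f) (hg : IsIrreducibleForm g)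
    (h1 : 0 ≤ inter (formClass p f + formClass p g) (formClass p f))
    (h2 : 0 ≤ inter (formClass p f + formClass p g) (formClass p g))
    (F : MvPolynomial (Fin 3) K) (hF : F.IsHomogeneous F.totalDegree) (hF0 : F ≠ 0) :
    0 ≤ inter (formClass p f + formClass p g) (formClass p F) := by
  -- Components associated to `f` or `g` are covered by `h1` and `h2`, all others by Bézout against
  -- both curves.
  induction F using WfDvdMonoid.induction_on_irreducible with
  | zero => exact absurd rfl hF0
  | unit u hu =>
    rw [formClass_eq_zero_of_totalDegree_eq_zero p hF0 (totalDegree_eq_zero_of_isUnit hu)]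
    simp [inter]
  | mul a q ha hq ih =>
    have hqh := isHomogeneous_of_dvd hF hF0 (Dvd.intro _ rfl : q ∣ q * a)
    have hah := isHomogeneous_of_dvd hF hF0 (Dvd.intro_left _ rfl : a ∣ q * a)
    rw [formClass_mul p hq.ne_zero ha, inter_add_right]
    refine add_nonneg ?_ (ih hah ha)
    by_cases hfq : f ∣ q
    · rwa [← formClass_eq_of_dvd_of_dvd p hf.ne_zero hq.ne_zero hfq
        (hf.1.dvd_symm hq hfq)]
    by_cases hgq : g ∣ q
    · rwa [← formClass_eq_of_dvd_of_dvd p hg.ne_zero hq.ne_zero hgq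
        (hg.1.dvd_symm hq hgq)]
    rw [inter_add_left]
    exact add_nonneg (hp.inter_nonneg hf hqh hq.ne_zero hfq)
      (hp.inter_nonneg hg hqh hq.ne_zero hgq)

/-- Two different `(-1)`-curves that both meet an effective class negatively are disjoint. -/
theorem DistinctAbscissas.inter_eq_zero (hp : DistinctAbscissas p)
    {f g : MvPolynomial (Fin 3) K} (hf : IsIrreducibleForm f) (hg : IsIrreducibleForm g)
    (hne : formClass p f ≠ formClass p g)
    (hff : inter (formClass p f) (formClass p f) = -1)
    (hgg : inter (formClass p g) (formClass p g) = -1) {d : ℕ} {m : Fin n → ℕ}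
    (hL : linearSystem p d m ≠ ⊥)
    (hfL : inter (formClass p f) ((d : ℤ), fun i => (m i : ℤ)) < 0)
    (hgL : inter (formClass p g) ((d : ℤ), fun i => (m i : ℤ)) < 0) :
    inter (formClass p f) (formClass p g) = 0 := by
  have h0 := hp.inter_nonneg hf hg.2 hg.ne_zero fun h =>
    hne (formClass_eq_of_dvd_of_dvd p hf.ne_zero hg.ne_zero h (hf.1.dvd_symm hg.1 h))
  by_contra hpos
  obtain ⟨F, hF, hF0⟩ := (Submodule.ne_bot_iff _).1 hL
  have hdeg := hF.1.totalDegree hF0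
  -- With $f\cdot g\ge1$, the sum meets each of `f`, `g` in at least $-1+1=0$; nefness then
  -- contradicts `hfL` and `hgL`.
  have hnef := hp.inter_add_nonneg hf hg
    (by rw [inter_add_left, hff, inter_comm (formClass p g)]; omega)
    (by rw [inter_add_left, hgg]; omega) F (by rw [hdeg]; exact hF.1) hF0
  have hle : inter (formClass p f + formClass p g) (formClass p F) ≤
      inter (formClass p f + formClass p g) ((d : ℤ), fun i => (m i : ℤ)) :=
    inter_le_inter_right (fun i => add_nonneg (Nat.cast_nonneg _) (Nat.cast_nonneg _))
      (congrArg Nat.cast hdeg)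
      fun i => Nat.cast_le.2 ((hasMultGE_iff_le_multAt hF0).1 (hF.2 i))
  rw [inter_add_left _ _ ((d : ℤ), fun i => (m i : ℤ))] at hle
  omega

end FormClass

/-! ### The combinatorics of the multiplicity vector. -/

section Combinatorics

variable {ι : Type*} [Fintype ι] [DecidableEq ι]

theorem sum_mul_sub_swap (x : ι → ℤ) {i j : ι} (hij : i ≠ j) :
    ∑ k, x k * (x k - x (Equiv.swap i j k)) = (x i - x j) ^ 2 := by
  rw [Fintype.sum_eq_add i j hij]
  · rw [Equiv.swap_apply_left, Equiv.swap_apply_right]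
    ring
  · rintro k ⟨hki, hkj⟩
    rw [Equiv.swap_apply_of_ne_of_ne hki hkj, sub_self, mul_zero]

/-- If a vector has product one less than its square with each of its other rearrangements, then
it is constant up to a change by one in one place. -/
theorem eq_update_of_forall_perm (x : ι → ℤ)
    (h : ∀ σ : Equiv.Perm ι, x ∘ σ = x ∨ ∑ k, x k * (x k - x (σ k)) = 1) :
    (∀ i j, x i = x j) ∨ ∃ i j, (x j = x i - 1 ∨ x j = x i + 1) ∧ ∀ k, k ≠ j → x k = x i := by
  have hswap : ∀ i j, x i ≠ x j → x i = x j + 1 ∨ x i = x j - 1 := by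
    intro i j hij
    have hne : i ≠ j := fun h => hij (congrArg x h)
    rcases h (Equiv.swap i j) with h1 | h1
    · exact absurd (by simpa using congrFun h1 j) hij
    · rw [sum_mul_sub_swap x hne, sq_eq_one_iff] at h1
      omega
  -- Two disjoint transpositions of unequal entries contribute two positive squares, whose sum
  -- cannot be `1`.
  have hdouble : ∀ i j k l, x i ≠ x j → x k ≠ x l → i ≠ k → i ≠ l → j ≠ k → j ≠ l → False := by
    intro i j k l hij hkl h1 h2 h3 h4
    have hne : i ≠ j := fun h => hij (congrArg x h)
    have hne' : k ≠ l := fun h => hkl (congrArg x h)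
    rcases h (Equiv.swap i j * Equiv.swap k l) with h5 | h5
    · have := congrFun h5 j
      simp [Equiv.swap_apply_of_ne_of_ne h3 h4] at this
      exact hij this
    · have h6 : ∀ t, x t * (x t - x ((Equiv.swap i j * Equiv.swap k l) t)) =
          x t * (x t - x (Equiv.swap i j t)) + x t * (x t - x (Equiv.swap k l t)) := by
        intro t
        rw [Equiv.Perm.mul_apply]
        by_cases ht : t = i ∨ t = j
        · have : Equiv.swap k l t = t := by
            rcases ht with rfl | rfl
            · exact Equiv.swap_apply_of_ne_of_ne h1 h2
            · exact Equiv.swap_apply_of_ne_of_ne h3 h4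
          rw [this]
          ring
        · push Not at ht
          have h7 : Equiv.swap i j t = t := Equiv.swap_apply_of_ne_of_ne ht.1 ht.2
          have h8 : Equiv.swap i j (Equiv.swap k l t) = Equiv.swap k l t := by
            by_cases htk : t = k
            · subst htk
              rw [Equiv.swap_apply_left, Equiv.swap_apply_of_ne_of_ne h2.symm h4.symm]
            by_cases htl : t = l
            · subst htl
              rw [Equiv.swap_apply_right, Equiv.swap_apply_of_ne_of_ne h1.symm h3.symm]
            rw [Equiv.swap_apply_of_ne_of_ne htk htl, h7]
          rw [h7, h8]
          ring
      simp_rw [h6] at h5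
      rw [Finset.sum_add_distrib, sum_mul_sub_swap x hne, sum_mul_sub_swap x hne'] at h5
      have h7 : 0 < (x i - x j) ^ 2 := by
        have := sub_ne_zero.2 hij
        positivity
      have h8 : 0 < (x k - x l) ^ 2 := by
        have := sub_ne_zero.2 hkl
        positivity
      omega
  by_cases hconst : ∀ i j, x i = x j
  · exact Or.inl hconst
  right
  push Not at hconst
  obtain ⟨i, j, hij⟩ := hconst
  by_cases hi : ∀ k, k ≠ i → x k = x j
  · exact ⟨j, i, (hswap i j hij).symm, hi⟩
  by_cases hj : ∀ k, k ≠ j → x k = x i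
  · exact ⟨i, j, (hswap j i hij.symm).symm, hj⟩
  -- Unequal entries differ by one, so three distinct values cannot occur. Hence `x k = x i` and `x
  -- l = x j`, and `i, j` and `k, l` are disjoint unequal pairs.
  exfalso
  push Not at hi hj
  obtain ⟨k, hki, hkj⟩ := hi
  obtain ⟨l, hlj, hli⟩ := hj
  have e1 := hswap i j hij
  have e2 := hswap k j hkj
  have e3 := hswap l i hli
  have e4 : x k = x i := by
    by_contra h'
    have := hswap k i h'
    omega
  have e5 : x l = x j := by
    by_contra h'
    have := hswap l j h'
    omega
  exact hdouble i j k l hij (by omega) hki.symm (fun h => hli (by rw [h]))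
    (fun h => hkj (by rw [h])) hlj.symm

end Combinatorics

/-! ### Permutations acting on classes. -/

section Permutations

variable {r : ℕ}

theorem cls_snd_zero (d m₀ : ℤ) (m : Fin r → ℤ) : (cls d m₀ m).2 0 = m₀ := rfl

theorem cls_snd_succ (d m₀ : ℤ) (m : Fin r → ℤ) (i : Fin r) : (cls d m₀ m).2 i.succ = m i := rfl

theorem inter_eq_sub_sum (a b : PicClass (r + 1)) :
    inter a b = a.1 * b.1 - a.2 0 * b.2 0 - ∑ i : Fin r, a.2 i.succ * b.2 i.succ := by
  rw [inter, Fin.sum_univ_succ]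
  ring

theorem permute_cls (σ : Equiv.Perm (Fin r)) (d m₀ : ℤ) (m : Fin r → ℤ) :
    permute σ (cls d m₀ m) = cls d m₀ (m ∘ σ) := rfl

theorem cls_eta (a : PicClass (r + 1)) : cls a.1 (a.2 0) (fun i => a.2 i.succ) = a :=
  Prod.ext rfl (Fin.cons_self_tail a.2)

theorem inter_permute_permute (σ : Equiv.Perm (Fin r)) (a b : PicClass (r + 1)) :
    inter (permute σ a) (permute σ b) = inter a b := by
  rw [inter_eq_sub_sum, inter_eq_sub_sum a b]
  congr 1
  exact Equiv.sum_comp σ fun i => a.2 i.succ * b.2 i.succ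

theorem permute_canonicalClass (σ : Equiv.Perm (Fin r)) :
    permute σ (canonicalClass (r + 1)) = canonicalClass (r + 1) :=
  cls_eta (canonicalClass (r + 1))

/-- The permutation `Equiv.Perm.decomposeFin.symm (0, σ)` of all `r + 1` indices fixes `0` and acts
as `σ` on the rest. -/
theorem permute_eq_comp_perm (σ : Equiv.Perm (Fin r)) (a : PicClass (r + 1)) :
    permute σ a = (a.1, a.2 ∘ Equiv.Perm.decomposeFin.symm (0, σ)) := by
  refine Prod.ext rfl (funext fun i => ?_)
  refine Fin.cases ?_ (fun i => ?_) i
  · simp [permute, cls]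
  · simp [permute, cls]

end Permutations

/-! ### Irreducible curves on the blow-up and the compound curve. -/

section Curves

variable {K : Type*} [Field K] {n : ℕ}

theorem isIrreducibleForm_eqn (C : PlaneCurve K) : IsIrreducibleForm C.eqn := by
  obtain ⟨h1, ⟨d, hd⟩, _⟩ := C.exists_eq.choose_spec
  exact ⟨h1, by rwa [PlaneCurve.eqn, hd.totalDegree h1.ne_zero]⟩

theorem PlaneCurve.ideal_eq_span_eqn (C : PlaneCurve K) : C.ideal = Ideal.span {C.eqn} :=
  C.exists_eq.choose_spec.2.2

theorem exists_irredCurve_toPic_eq (p : Fin n → Plane K) {g : MvPolynomial (Fin 3) K}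
    (hg : IsIrreducibleForm g) : ∃ F : IrredCurve p, F.toPic = formClass p g := by
  let C : PlaneCurve K := ⟨Ideal.span {g}, g, hg.1, ⟨_, hg.2⟩, rfl⟩
  have h : Associated g C.eqn := Ideal.span_singleton_eq_span_singleton.1 C.ideal_eq_span_eqn
  exact ⟨.strictTransform C, formClass_eq_of_dvd_of_dvd p (isIrreducibleForm_eqn C).ne_zero
    hg.ne_zero h.symm.dvd h.dvd⟩

/-- Positive degree excludes exceptional curves. Equations of equal negative class divide each
other, hence generate the same ideal, which determines the curve. -/
theorem DistinctAbscissas.eq_of_toPic_eq {p : Fin n → Plane K} (hp : DistinctAbscissas p)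
    {F F' : IrredCurve p} (h : F.toPic = F'.toPic) (hneg : inter F.toPic F.toPic < 0)
    (hpos : 0 < F.toPic.1) : F = F' := by
  cases F with
  | exceptional i => exact absurd hpos (lt_irrefl 0)
  | strictTransform C =>
    cases F' with
    | exceptional i =>
      rw [h] at hpos
      exact absurd hpos (lt_irrefl 0)
    | strictTransform C' =>
      have hC := isIrreducibleForm_eqn C
      have hC' := isIrreducibleForm_eqn C'
      have h1 := hp.dvd_of_formClass_eq hC hC' h hneg
      have h2 := hC.1.dvd_symm hC'.1 h1
      have h3 : C.ideal = C'.ideal := by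
        rw [C.ideal_eq_span_eqn, C'.ideal_eq_span_eqn]
        exact Ideal.span_singleton_eq_span_singleton.2 (associated_of_dvd_dvd h1 h2)
      cases C
      cases C'
      cases h3
      rfl

variable {r : ℕ} {p : Fin (r + 1) → Plane K}

theorem isMinusOne_of_toPic_eq_permute {E F : IrredCurve p} (hE : E.IsMinusOne)
    {σ : Equiv.Perm (Fin r)} (h : F.toPic = permute σ E.toPic) : F.IsMinusOne := by
  refine ⟨?_, ?_⟩
  · rw [h, inter_permute_permute]
    exact hE.1
  · rw [h, ← permute_canonicalClass σ, inter_permute_permute]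
    exact hE.2

theorem finite_conjugates {E : IrredCurve p} (hE : E.IsMinusOne)
    (hex : ∀ σ : Equiv.Perm (Fin r),
      ∃! F : IrredCurve p, F.IsMinusOne ∧ F.toPic = permute σ E.toPic) :
    (conjugates E).Finite := by
  choose F _ hF' using hex
  refine (Set.finite_range F).subset ?_
  rintro G ⟨σ, hG⟩
  exact ⟨σ, (hF' σ G ⟨isMinusOne_of_toPic_eq_permute hE hG, hG⟩).symm⟩

theorem divisorClass_sum {ι : Type*} (s : Finset ι) (D : ι → BlowupDivisor p) :
    divisorClass (∑ i ∈ s, D i) = ∑ i ∈ s, divisorClass (D i) :=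
  map_sum (Finsupp.linearCombination ℤ (IrredCurve.toPic (p := p))) D s

theorem divisorClass_single (F : IrredCurve p) : divisorClass (Finsupp.single F 1) = F.toPic := by
  simp [divisorClass]

/-- The conjugates correspond to the `r` positions of the odd entry, distinct positions giving
distinct classes since `ε ≠ 0`. Each coordinate receives `μ` from all of them and `ε` exactly once.
-/
theorem divisorClass_compound {E : IrredCurve p} (hE : E.IsMinusOne)
    (hex : ∀ σ : Equiv.Perm (Fin r),
      ∃! F : IrredCurve p, F.IsMinusOne ∧ F.toPic = permute σ E.toPic)
    {δ μ₀ μ ε : ℤ} (hε : ε ≠ 0) {j : Fin r}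
    (h : E.toPic = cls δ μ₀ (Function.update (fun _ => μ) j (μ + ε))) :
    divisorClass (compound E) = cls (r * δ) (r * μ₀) (fun _ => r * μ + ε) := by
  choose F hF hF' using hex
  have hperm : ∀ σ : Equiv.Perm (Fin r), permute σ E.toPic =
      cls δ μ₀ (Function.update (fun _ => μ) (σ.symm j) (μ + ε)) := by
    intro σ
    rw [h, permute_cls]
    congr 1
    funext k
    simp only [Function.comp_apply, Function.update_apply, Equiv.eq_symm_apply]
  -- The transposition of `i` and `j` moves the odd entry to position `i`.
  let G : Fin r → IrredCurve p := fun i => F (Equiv.swap i j)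
  have hG : ∀ i, (G i).toPic = cls δ μ₀ (Function.update (fun _ => μ) i (μ + ε)) := by
    intro i
    rw [(hF (Equiv.swap i j)).2, hperm, Equiv.symm_swap, Equiv.swap_apply_right]
  have hinj : Function.Injective G := by
    intro i i' hii
    by_contra hne
    have h1 := congrArg (fun F => F.toPic.2 i.succ) hii
    simp only [hG, cls_snd_succ, Function.update_self, Function.update_of_ne hne] at h1
    omega
  have hrange : conjugates E = Set.range G := by
    ext H
    constructor
    · rintro ⟨σ, hH⟩
      have h1 : ∀ τ, H.toPic = permute τ E.toPic → H = F τ := fun τ hτ =>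
        hF' τ H ⟨isMinusOne_of_toPic_eq_permute hE hτ, hτ⟩
      refine ⟨σ.symm j, (h1 _ ?_).symm⟩
      rw [hH, hperm, hperm, Equiv.symm_swap, Equiv.swap_apply_right]
    · rintro ⟨i, rfl⟩
      exact ⟨_, (hF (Equiv.swap i j)).2⟩
  rw [compound, hrange, finsum_mem_range hinj, finsum_eq_sum_of_fintype, divisorClass_sum]
  simp_rw [divisorClass_single, hG]
  refine Prod.ext ?_ (funext fun k => ?_)
  · simp [cls, Prod.fst_sum]
  · rw [Prod.snd_sum, Finset.sum_apply]
    refine Fin.cases ?_ (fun k => ?_) k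
    · simp [cls_snd_zero]
    · simp only [cls_snd_succ]
      have : ∀ i, Function.update (fun _ => μ) i (μ + ε) k = μ + if i = k then ε else 0 := by
        intro i
        rw [Function.update_apply]
        by_cases hik : k = i
        · simp [hik]
        · simp [hik, Ne.symm hik]
      simp_rw [this]
      simp [Finset.sum_add_distrib]

end Curves

end PlaneSystems

/-! ### The main theorem. -/

open PlaneSystems in
theorem mainTheorem3 {K : Type*} [Field K] [IsAlgClosed K] (r d m₀ m : ℕ) :
    ForGeneralPoints K (r + 1) fun p =>
      -- the quasi-homogeneous system `𝓛(d, m₀, mʳ)` is nonempty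
      linearSystem p d (Fin.cons m₀ fun _ => m) ≠ ⊥ →
      ∀ E : IrredCurve p, E.IsMinusOne →
        inter E.toPic (cls (d : ℤ) (m₀ : ℤ) fun _ : Fin r => (m : ℤ)) < 0 →
        -- `E` has one of the three forms
        (∃ δ μ₀ μ : ℕ,
          E.toPic = cls (δ : ℤ) (μ₀ : ℤ) (fun _ : Fin r => (μ : ℤ)) ∨
          (∃ j : Fin r, 1 ≤ μ ∧
            E.toPic = cls (δ : ℤ) (μ₀ : ℤ) (Function.update (fun _ => (μ : ℤ)) j (μ - 1))) ∨
          (∃ j : Fin r,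
            E.toPic = cls (δ : ℤ) (μ₀ : ℤ) (Function.update (fun _ => (μ : ℤ)) j (μ + 1)))) ∧
        -- every `E_σ` is a well-defined `(-1)`-curve, and there are finitely many of them
        (∀ σ : Equiv.Perm (Fin r),
          ∃! F : IrredCurve p, F.IsMinusOne ∧ F.toPic = permute σ E.toPic) ∧
        (conjugates E).Finite ∧
        -- the class of the compound curve in the last two cases
        (∀ (δ μ₀ μ : ℤ) (j : Fin r),
          E.toPic = cls δ μ₀ (Function.update (fun _ => μ) j (μ - 1)) →
            divisorClass (compound E) = cls (r * δ) (r * μ₀) (fun _ => r * μ - 1)) ∧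
        (∀ (δ μ₀ μ : ℤ) (j : Fin r),
          E.toPic = cls δ μ₀ (Function.update (fun _ => μ) j (μ + 1)) →
            divisorClass (compound E) = cls (r * δ) (r * μ₀) (fun _ => r * μ + 1)) := by
  have : Infinite K := IsAlgClosed.instInfinite
  -- The bound `d` suffices because `hδ` below shows that `E` has degree at most `d`.
  refine forGeneralPoints_of_generalPosition d fun p hp hfew hL E hE hEL => ?_
  cases E with
  -- An exceptional curve meets the system in `m₀` or `m`, which is nonnegative.
  | exceptional i =>
    exfalso
    refine absurd hEL (not_lt.2 ?_)
    simp only [inter, IrredCurve.toPic, zero_mul, ite_mul, Finset.sum_ite_eq', Finset.mem_univ,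
      if_true, zero_sub]
    refine Fin.cases ?_ (fun k => ?_) i
    · simp [cls_snd_zero]
    · simp [cls_snd_succ]
  | strictTransform C =>
    set f := C.eqn with hf_def
    have hf : IsIrreducibleForm f := isIrreducibleForm_eqn C
    have hfE : (IrredCurve.strictTransform C : IrredCurve p).toPic = formClass p f := rfl
    generalize hE' : (IrredCurve.strictTransform C : IrredCurve p) = E at *
    have hLcls : (cls (d : ℤ) (m₀ : ℤ) fun _ : Fin r => (m : ℤ)) =
        ((d : ℤ), fun i => ((Fin.cons m₀ fun _ => m : Fin (r + 1) → ℕ) i : ℤ)) := by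
      refine Prod.ext rfl (funext fun i => ?_)
      refine Fin.cases ?_ (fun k => ?_) i <;> simp [cls]
    have hff : inter (formClass p f) (formClass p f) = -1 := hfE ▸ hE.1
    have hfL : inter (formClass p f)
        ((d : ℤ), fun i => ((Fin.cons m₀ fun _ => m : Fin (r + 1) → ℕ) i : ℤ)) < 0 := by
      rw [← hLcls, ← hfE]
      exact hEL
    have hδ : f.totalDegree ≤ d := by
      obtain ⟨F, hF, hF0⟩ := (Submodule.ne_bot_iff _).1 hL
      have h1 := MvPolynomial.totalDegree_le_of_dvd_of_isDomain (hp.dvd_of_inter_neg hf hF hfL) hF0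
      rwa [hF.1.totalDegree hF0] at h1
    have hconj : ∀ σ : Equiv.Perm (Fin r), ∃ g, IsIrreducibleForm g ∧
        formClass p g = permute σ (formClass p f) := by
      intro σ
      obtain ⟨g, hg, hgf⟩ := exists_isIrreducibleForm_perm hp hfew hf hδ (by omega)
        (Equiv.Perm.decomposeFin.symm (0, σ))
      exact ⟨g, hg, by rw [hgf, permute_eq_comp_perm]; rfl⟩
    have hex : ∀ σ : Equiv.Perm (Fin r),
        ∃! F : IrredCurve p, F.IsMinusOne ∧ F.toPic = permute σ E.toPic := by
      intro σ
      obtain ⟨g, hg, hgf⟩ := hconj σ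
      obtain ⟨F, hF⟩ := exists_irredCurve_toPic_eq p hg
      have hF' : F.toPic = permute σ E.toPic := by rw [hF, hgf, hfE]
      have hF1 := isMinusOne_of_toPic_eq_permute hE hF'
      refine ⟨F, ⟨hF1, hF'⟩, ?_⟩
      rintro F' ⟨-, h'⟩
      refine (hp.eq_of_toPic_eq (hF'.trans h'.symm) (by rw [hF1.1]; norm_num) ?_).symm
      rw [hF]
      exact Nat.cast_pos.2 hg.totalDegree_pos
    refine ⟨?_, hex, finite_conjugates hE hex, fun δ μ₀ μ j h => ?_, fun δ μ₀ μ j h => ?_⟩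
    · let x : Fin r → ℤ := fun i => (multAt f (p i.succ) : ℤ)
      have hx : E.toPic = cls (f.totalDegree : ℤ) (multAt f (p 0) : ℤ) x := by
        rw [hfE, ← cls_eta (formClass p f)]
        rfl
      have hcomb := eq_update_of_forall_perm x fun σ => by
        by_cases hσ : x ∘ σ = x
        · exact Or.inl hσ
        right
        obtain ⟨g, hg, hgf⟩ := hconj σ
        rw [← hfE, hx, permute_cls] at hgf
        rw [hfE] at hx
        have hgg : inter (formClass p g) (formClass p g) = -1 := by
          rw [hgf, ← permute_cls, inter_permute_permute, ← hx, hff]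
        -- The quasi-homogeneous class is fixed by `σ`, so both curves meet it in the same number.
        have hgL : inter (formClass p g)
            ((d : ℤ), fun i => ((Fin.cons m₀ fun _ => m : Fin (r + 1) → ℕ) i : ℤ)) < 0 := by
          rw [← hLcls, hgf, ← permute_cls]
          have h1 := inter_permute_permute σ (formClass p f)
            (cls (d : ℤ) (m₀ : ℤ) fun _ : Fin r => (m : ℤ))
          rw [hLcls] at h1
          rw [← hx]
          refine lt_of_eq_of_lt ?_ hfL
          rw [← h1, ← hLcls]
          rfl
        have hne : formClass p f ≠ formClass p g := by
          rw [hgf, hx]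
          intro h
          apply hσ
          funext i
          exact (congrArg (fun a => a.2 i.succ) h).symm
        -- Subtracting $E^2=-1$ from $E\cdot E_\sigma=0$ cancels the degree and the multiplicity at
        -- `p 0`, leaving the sum required by the combinatorial lemma.
        have h0 := hp.inter_eq_zero hf hg hne hff hgg hL hfL hgL
        rw [hgf, hx, inter_eq_sub_sum] at h0
        rw [hx, inter_eq_sub_sum] at hff
        simp only [cls_snd_succ, cls_snd_zero, Function.comp_apply] at h0 hff
        simp_rw [mul_sub]
        rw [Finset.sum_sub_distrib]
        change (f.totalDegree : ℤ) * f.totalDegree - _ - _ = _ at h0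
        change (f.totalDegree : ℤ) * f.totalDegree - _ - _ = _ at hff
        omega
      rcases hcomb with hc | ⟨i, j, hj, hk⟩
      · rcases isEmpty_or_nonempty (Fin r) with he | ⟨⟨i⟩⟩
        -- For `r = 0` there is no entry to read `μ` from, and any value serves.
        · exact ⟨f.totalDegree, multAt f (p 0), 0, Or.inl (by
            rw [hx]
            congr 1
            exact Subsingleton.elim _ _)⟩
        · refine ⟨f.totalDegree, multAt f (p 0), multAt f (p i.succ), Or.inl ?_⟩
          rw [hx]
          congr 1
          funext k
          exact hc k i
      · have hxj : x = Function.update (fun _ => x i) j (x j) := by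
          funext k
          rw [Function.update_apply]
          split_ifs with h
          · rw [h]
          · exact hk k h
        refine ⟨f.totalDegree, multAt f (p 0), multAt f (p i.succ), Or.inr ?_⟩
        rw [hx, hxj]
        rcases hj with hj | hj
        · refine Or.inl ⟨j, ?_, by rw [hj]⟩
          -- The odd entry `μ - 1` is itself a multiplicity, whence `1 ≤ μ`.
          have : 0 ≤ x j := Nat.cast_nonneg _
          have : (1 : ℤ) ≤ x i := by omega
          exact Nat.cast_le.1 this
        · exact Or.inr ⟨j, by rw [hj]⟩
    · have := divisorClass_compound hE hex (ε := -1) (by norm_num) h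
      simpa [sub_eq_add_neg] using this
    · exact divisorClass_compound hE hex one_ne_zero h
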